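/- Conventions. For $f$ on $\mathbf R^n$ put $\hat f(\xi)=\int_{\mathbf R^n}e^{-ix\cdot\xi}f(x)\,dx$ (extended to $L^2$ as usual), and let $\mathcal F^{-1}$ be the inverse transform. For $\theta>0$ let $L_\theta=\log(I+(-\Delta)^\theta)$ be the operator in $L^2(\mathbf R^n)$ with symbol $\log(1+|\xi|^{2\theta})$, with domain $\{f\in L^2:\log(1+|\xi|^{2\theta})\hat f\in L^2\}$. For $\gamma>0$ let $L^{1,\gamma}(\mathbf R^n)$ be the space of $f\in L^1(\mathbf R^n)$ with $\|f\|_{L^{1,\gamma}}:=\int_{\mathbf R^n}(1+|x|^\gamma)|f(x)|\,dx<\infty$. Functions may be real- or complex-valued. Consider the Cauchy problem $$u_{tt}-\Delta u+L_\theta u_t=0\quad\text{in }(0,\infty)\times\mathbf R^n,\qquad u(0,\cdot)=0,\quad u_t(0,\cdot)=u_1 .$$ A mild solution is a $u\in C([0,\infty);H^1(\mathbf R^n))\cap C^1([0,\infty);L^2(\mathbf R^n))$ with $u(0)=0$, $u_t(0)=u_1$ such that for all $t\ge0$: $\int_0^tu(s)\,ds\in H^2(\mathbf R^n)$ and $u_t(t)=u_1+\Delta\int_0^tu(s)\,ds-L_\theta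 u(t)$. With $P_1=\int_{\mathbf R^n}u_1(x)\,dx$ put $$\varphi(t,\xi)=P_1\,\frac{e^{-t|\xi|^2/\log(1+|\xi|^{2\theta})}-e^{-t\log(1+|\xi|^{2\theta})}}{\log(1+|\xi|^{2\theta})}.$$ Theorem 1.1. Let $n\ge1$. There is a constant $C>0$ depending only on $n$, and for every $\theta$ with $0<\theta\le\frac13$ (if $n=1$) or $0<\theta\le\frac5{12}$ (if $n\ge2$) there is a $T>0$ depending only on $n$ and $\theta$, such that the following holds for every $u_1\in L^{1,2\theta}(\mathbf R^n)\cap L^2(\mathbf R^n)$. The Cauchy problem has a unique mild solution $u$, and for all $t\ge T$ one has $\varphi(t,\cdot)\in L^2(\mathbf R^n)$ and $$\|u(t,\cdot)-\mathcal F^{-1}_{\xi\to x}(\varphi(t,\xi))\|_{L^2}\le C\left(\|u_1\|_{L^1}+\|u_1\|_{L^{1,2\theta}}\right)\rho(t),$$ where: (I) if $n=1$, $$\rho(t)=\begin{cases}t^{-\frac1{4(1-\theta)}}+\frac1{\sqrt\theta}\,t^{-\frac1{4\theta}},&0<\theta\le\frac16,\\[2pt] t^{-\frac1{4(1-\theta)}}+\frac1{\sqrt\theta}\,t^{-\frac{5/3-4\theta}{4\theta}},&\frac16<\theta\le\frac13;\end{cases}$$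 (II) if $n\ge2$, $$\rho(t)=\begin{cases}t^{-\frac n{4(1-\theta)}}+\frac1{\sqrt\theta}\,t^{-\frac n{4\theta}},&0<\theta\le\frac16,\\[2pt] t^{-\frac n{4(1-\theta)}}+\frac1{\sqrt\theta}\,t^{-\frac{n-4\theta+2/3}{4\theta}},&\frac16<\theta\le\frac13,\\[2pt] t^{-\frac{n-1}{4(1-\theta)}}+\frac1{\sqrt\theta}\,t^{-\frac{n-1}{4\theta}},&\frac13<\theta\le\frac5{12}.\end{cases}$$ -/

import Mathlib

open MeasureTheory Set
open scoped FourierTransform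

noncomputable section

namespace LogDampedWave

/-- `ℝⁿ` with its Euclidean norm. -/
abbrev Space (n : ℕ) : Type := EuclideanSpace ℝ (Fin n)

/-- The complex Hilbert space `L²(ℝⁿ)`. -/
abbrev L2 (n : ℕ) : Type := Lp ℂ 2 (volume : Measure (Space n))

/-- The Fourier transform of `f ∈ L²(ℝⁿ)` in the normalization `f̂(ξ) = ∫ e^{-i x·ξ} f(x) dx`.
Mathlib's `𝓕` is `w ↦ ∫ e^{-2πi x·w} f(x) dx`, so `f̂(ξ) = (𝓕 f)(ξ / 2π)`. -/
def hat {n : ℕ} (f : L2 n) : Space n → ℂ :=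
  fun ξ => (𝓕 f : L2 n) ((2 * Real.pi)⁻¹ • ξ)

theorem memLp_dilate {n : ℕ} {g : Space n → ℂ} (hg : MemLp g 2 volume) :
    MemLp (fun w : Space n => g ((2 * Real.pi) • w)) 2 volume := by
  have hc : (2 * Real.pi) ≠ 0 := by positivity
  refine MemLp.comp_of_map (f := fun w : Space n => (2 * Real.pi) • w) ?_ (by fun_prop)
  rw [Measure.map_addHaar_smul _ hc]
  exact hg.smul_measure ENNReal.ofReal_ne_top

/-- The inverse Fourier transform `x ↦ (2π)⁻ⁿ ∫ e^{i x·ξ} g(ξ) dξ` of `g ∈ L²(ℝⁿ)`,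
i.e. the inverse of `hat`. -/
def invHat {n : ℕ} (g : Space n → ℂ) (hg : MemLp g 2 volume) : L2 n :=
  𝓕⁻ ((memLp_dilate hg).toLp (fun w : Space n => g ((2 * Real.pi) • w)) : L2 n)

/-- The graph of the Fourier multiplier operator with real symbol `m`, on its maximal domain
`{f ∈ L² | m f̂ ∈ L²}`: `f` lies in the domain and is mapped to `g ∈ L²`, i.e. `ĝ = m f̂`. -/
def IsMultiplier {n : ℕ} (m : Space n → ℝ) (f g : L2 n) : Prop :=
  hat g =ᵐ[volume] fun ξ => (m ξ : ℂ) * hat f ξ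

/-- The symbol `log (1 + |ξ|^{2θ})` of `L_θ = log (I + (-Δ)^θ)`. -/
def logSymbol {n : ℕ} (θ : ℝ) (ξ : Space n) : ℝ := Real.log (1 + ‖ξ‖ ^ (2 * θ))

/-- `f ∈ D(L_θ)` and `L_θ f = g`. -/
def IsLog {n : ℕ} (θ : ℝ) (f g : L2 n) : Prop := IsMultiplier (logSymbol θ) f g

/-- `f ∈ H²(ℝⁿ)` and `Δ f = g`. -/
def IsLaplacian {n : ℕ} (f g : L2 n) : Prop := IsMultiplier (fun ξ => -‖ξ‖ ^ 2) f g

/-- `u ∈ C([0,∞); H¹(ℝⁿ))`, where `‖f‖_{H¹} = ‖(1 + |ξ|²)^{1/2} f̂‖` up to a constant factor: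
`(I - Δ)^{1/2} u` is defined and is a continuous curve in `L²`. -/
def ContinuousH1 {n : ℕ} (u : ℝ → L2 n) : Prop :=
  ∃ w : ℝ → L2 n, ContinuousOn w (Ici 0) ∧
    ∀ t, 0 ≤ t → IsMultiplier (fun ξ => Real.sqrt (1 + ‖ξ‖ ^ 2)) (u t) (w t)

/-- Mild solutions of `u_tt - Δu + L_θ u_t = 0`, `u(0) = u₀`, `u_t(0) = u₁` on `[0,∞)`:
`u ∈ C([0,∞); H¹) ∩ C¹([0,∞); L²)`, and `U = (u, u_t)` is a mild solution of `U' = A U` in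
`H¹ × L²`, where `A (u, v) = (v, Δu - L_θ v)` with domain `H² × H¹`. That is,
`∫₀ᵗ U ds ∈ D(A)` and `U(t) = U(0) + A ∫₀ᵗ U ds` for all `t ≥ 0`. As `∫₀ᵗ u_t ds = u(t) - u₀`,
the second component reads `u_t(t) = u₁ + Δ ∫₀ᵗ u ds - L_θ (u(t) - u₀)`.
Only the values of `u` on `[0,∞)` matter. -/
def IsMildSolution {n : ℕ} (θ : ℝ) (u₀ u₁ : L2 n) (u : ℝ → L2 n) : Prop :=
  ContinuousH1 u ∧ u 0 = u₀ ∧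
    ∃ v : ℝ → L2 n, ContinuousOn v (Ici 0) ∧
      (∀ t, 0 ≤ t → HasDerivWithinAt u (v t) (Ici 0) t) ∧ v 0 = u₁ ∧
      ∀ t, 0 ≤ t → ∃ a d : L2 n,
        IsLaplacian (∫ s in (0 : ℝ)..t, u s) a ∧ IsLog θ (u t - u₀) d ∧ v t = u₁ + a - d

/-- The weighted space `L^{1,γ}(ℝⁿ)`. -/
def MemL1Weighted {n : ℕ} (γ : ℝ) (f : Space n → ℂ) : Prop :=
  Integrable f volume ∧ Integrable (fun x => (1 + ‖x‖ ^ γ) * ‖f x‖) volume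

/-- The norm `∫ (1 + |x|^γ) |f(x)| dx` of `L^{1,γ}(ℝⁿ)`. -/
def normL1Weighted {n : ℕ} (γ : ℝ) (f : Space n → ℂ) : ℝ :=
  ∫ x, (1 + ‖x‖ ^ γ) * ‖f x‖

/-- The norm of `L¹(ℝⁿ)`. -/
def normL1 {n : ℕ} (f : Space n → ℂ) : ℝ := ∫ x, ‖f x‖

/-- The profile `φ(t, ξ)` for initial velocity `u₁`, with `b = log (1 + |ξ|^{2θ})` and
`P₁ = ∫ u₁`: `(e^{-t |ξ|² / b} / b - e^{-t b} / b) P₁`. -/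
def profile {n : ℕ} (θ : ℝ) (u₁ : Space n → ℂ) (t : ℝ) (ξ : Space n) : ℂ :=
  ((Real.exp (-(‖ξ‖ ^ 2 / logSymbol θ ξ) * t) / logSymbol θ ξ
    - Real.exp (-logSymbol θ ξ * t) / logSymbol θ ξ : ℝ) : ℂ) * ∫ x, u₁ x

end LogDampedWave

end

/-! On the Fourier side the solution is K û₁, where K (`kernel`) solves K'' + bK' + r²K = 0, K(0) =
0, K'(0) = 1, with r = |ξ| and b = log(1 + r^{2θ}). The profile is K₀ P₁, where K₀ (`profileKernel`)
replaces the characteristic roots by -r²/b and -b and their gap by b. The error splits as K û₁ - K₀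
P₁ = K(û₁ - P₁) + (K - K₀)P₁.

For r ≤ δ = 1/32768 the damping dominates. The moment of order 2θ gives |û₁ - P₁| ≲ r^{2θ}, which
cancels the factor 1/b in K (`norm_fourier_sub_integral_le`), and expanding the roots gives |K - K₀|
≲ r²/b³ ≲ r^{2-6θ} (`abs_kernel_sub_profileKernel_le`), both times exp(-t r^{2-2θ}/2). If 2 - 6θ ≥
-a/2, the squared error is at most a multiple of r^{-a} exp(-t r^{2-2θ}), whose integral for a < n
is of order t^{-(n-a)/(2-2θ)} by scaling. The choice a = 0 serves θ ≤ 1/3; a = 1 serves θ ≤ 5/12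
when n ≥ 2.

For r ≥ δ both kernels are controlled by (t + 1/b) exp(-δ² b t). As b ≥ 2θ log(1 + r), this is
square integrable in ξ after a time depending on n and θ, and then decays exponentially in t. Taking
T large puts this part below the low-frequency rate with coefficient 1, so C depends on n only. The
first term of ρ therefore suffices; the second is added at the end.

Existence follows from energy bounds on K, which make all the symbols involved bounded in ξ. For
uniqueness, a cutoff to a frequency ball turns the equation into a linear ODE in L² with bounded
coefficients. -/

noncomputable section

namespace LogDampedWave

open Filter Topology SchwartzMap
open scoped ContDiff

/-! ### The damped oscillator at a fixed frequency -/

/-- The solution of `y'' = D y`, `y 0 = 0`, `y' 0 = 1`. -/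
def oscSine (D t : ℝ) : ℝ :=
  if 0 < D then Real.sinh (√D * t) / √D
  else if D < 0 then Real.sin (√(-D) * t) / √(-D) else t

/-- The solution of `y'' = D y`, `y 0 = 1`, `y' 0 = 0`. -/
def oscCosine (D t : ℝ) : ℝ :=
  if 0 < D then Real.cosh (√D * t) else Real.cos (√(-D) * t)

theorem hasDerivAt_oscSine (D t : ℝ) : HasDerivAt (oscSine D) (oscCosine D t) t := by
  rcases lt_trichotomy D 0 with h | h | h
  · have h0 : √(-D) ≠ 0 := (Real.sqrt_pos.2 (neg_pos.2 h)).ne'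
    have e : oscSine D = fun t => Real.sin (√(-D) * t) / √(-D) := by
      funext s; simp [oscSine, h, h.le]
    rw [e]
    have := (((hasDerivAt_id t).const_mul (√(-D))).sin).div_const (√(-D))
    convert! this using 1
    simp [oscCosine, h.le, h0]
  · subst h
    have e : oscSine 0 = fun t => t := by funext s; simp [oscSine]
    rw [e]
    simpa [oscCosine] using hasDerivAt_id' t
  · have h0 : √D ≠ 0 := (Real.sqrt_pos.2 h).ne'
    have e : oscSine D = fun t => Real.sinh (√D * t) / √D := by
      funext s; simp [oscSine, h]
    rw [e]
    have := (((hasDerivAt_id t).const_mul (√D)).sinh).div_const (√D)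
    convert! this using 1
    simp [oscCosine, h, h0]

theorem hasDerivAt_oscCosine (D t : ℝ) : HasDerivAt (oscCosine D) (D * oscSine D t) t := by
  rcases lt_trichotomy D 0 with h | h | h
  · have h0 : √(-D) ≠ 0 := (Real.sqrt_pos.2 (neg_pos.2 h)).ne'
    have e : oscCosine D = fun t => Real.cos (√(-D) * t) := by
      funext s; simp [oscCosine, h.le]
    rw [e]
    have := ((hasDerivAt_id t).const_mul (√(-D))).cos
    convert! this using 1
    have hs : √(-D) * √(-D) = -D := Real.mul_self_sqrt (by linarith)
    simp only [oscSine, h, not_lt.2 h.le, if_false, if_true, id]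
    field_simp
    rw [pow_two, hs]; ring
  · subst h
    have e : oscCosine 0 = fun _ => 1 := by funext s; simp [oscCosine]
    rw [e]
    simpa using hasDerivAt_const t (1 : ℝ)
  · have h0 : √D ≠ 0 := (Real.sqrt_pos.2 h).ne'
    have e : oscCosine D = fun t => Real.cosh (√D * t) := by
      funext s; simp [oscCosine, h]
    rw [e]
    have := ((hasDerivAt_id t).const_mul (√D)).cosh
    convert! this using 1
    have hs : √D * √D = D := Real.mul_self_sqrt h.le
    simp only [oscSine, h, if_true, id]
    field_simp
    rw [pow_two, hs]

/-- The solution of `y'' + b y' + r² y = 0`, `y 0 = 0`, `y' 0 = 1`. -/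
def kernel (b r t : ℝ) : ℝ := Real.exp (-(b / 2) * t) * oscSine (b ^ 2 / 4 - r ^ 2) t

/-- The time derivative of `kernel`. -/
def kernelDeriv (b r t : ℝ) : ℝ :=
  Real.exp (-(b / 2) * t) *
    (oscCosine (b ^ 2 / 4 - r ^ 2) t - b / 2 * oscSine (b ^ 2 / 4 - r ^ 2) t)

theorem hasDerivAt_kernel (b r t : ℝ) : HasDerivAt (kernel b r) (kernelDeriv b r t) t := by
  have h1 : HasDerivAt (fun t => Real.exp (-(b / 2) * t))
      (Real.exp (-(b / 2) * t) * (-(b / 2))) t := by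
    simpa using ((hasDerivAt_id t).const_mul (-(b / 2))).exp
  convert! h1.mul (hasDerivAt_oscSine (b ^ 2 / 4 - r ^ 2) t) using 1
  simp only [kernelDeriv]; ring

theorem hasDerivAt_kernelDeriv (b r t : ℝ) :
    HasDerivAt (kernelDeriv b r) (-(b * kernelDeriv b r t) - r ^ 2 * kernel b r t) t := by
  have h1 : HasDerivAt (fun t => Real.exp (-(b / 2) * t))
      (Real.exp (-(b / 2) * t) * (-(b / 2))) t := by
    simpa using ((hasDerivAt_id t).const_mul (-(b / 2))).exp
  convert! h1.mul ((hasDerivAt_oscCosine (b ^ 2 / 4 - r ^ 2) t).sub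
    ((hasDerivAt_oscSine (b ^ 2 / 4 - r ^ 2) t).const_mul (b / 2))) using 1
  simp only [kernelDeriv, kernel, Pi.sub_apply]; ring

@[simp] theorem kernel_zero (b r : ℝ) : kernel b r 0 = 0 := by simp [kernel, oscSine]

@[simp] theorem kernelDeriv_zero (b r : ℝ) : kernelDeriv b r 0 = 1 := by
  simp [kernelDeriv, oscSine, oscCosine]

theorem continuous_kernel (b r : ℝ) : Continuous (kernel b r) :=
  continuous_iff_continuousAt.2 fun t => (hasDerivAt_kernel b r t).continuousAt

theorem continuous_kernelDeriv (b r : ℝ) : Continuous (kernelDeriv b r) :=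
  continuous_iff_continuousAt.2 fun t => (hasDerivAt_kernelDeriv b r t).continuousAt

/-- The energy has derivative -2b(K')² ≤ 0 and starts at 1. All bounds on K that are uniform in the
frequency come from here. -/
theorem kernel_energy_le {b r t : ℝ} (hb : 0 ≤ b) (ht : 0 ≤ t) :
    kernelDeriv b r t ^ 2 + r ^ 2 * kernel b r t ^ 2 ≤ 1 := by
  have hd : ∀ s, HasDerivAt (fun s => kernelDeriv b r s ^ 2 + r ^ 2 * kernel b r s ^ 2)
      (-2 * b * kernelDeriv b r s ^ 2) s := fun s => by
    convert! ((hasDerivAt_kernelDeriv b r s).pow 2).add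
      (((hasDerivAt_kernel b r s).pow 2).const_mul (r ^ 2)) using 1
    push_cast; ring
  have hanti : Antitone (fun s => kernelDeriv b r s ^ 2 + r ^ 2 * kernel b r s ^ 2) := by
    refine antitone_of_deriv_nonpos (fun s => (hd s).differentiableAt) fun s => ?_
    rw [(hd s).deriv]
    have := mul_nonneg hb (sq_nonneg (kernelDeriv b r s))
    linarith
  simpa using hanti ht

theorem abs_kernelDeriv_le {b r t : ℝ} (hb : 0 ≤ b) (ht : 0 ≤ t) : |kernelDeriv b r t| ≤ 1 := by
  have h := kernel_energy_le (r := r) hb ht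
  rw [abs_le_one_iff_mul_self_le_one]
  have := mul_nonneg (sq_nonneg r) (sq_nonneg (kernel b r t))
  nlinarith

theorem mul_abs_kernel_le {b r t : ℝ} (hb : 0 ≤ b) (hr : 0 ≤ r) (ht : 0 ≤ t) :
    r * |kernel b r t| ≤ 1 := by
  have h := kernel_energy_le (r := r) hb ht
  have h1 : (r * |kernel b r t|) ^ 2 ≤ 1 := by
    rw [mul_pow, sq_abs]; linarith [sq_nonneg (kernelDeriv b r t)]
  exact (sq_le_one_iff₀ (by positivity)).1 h1

theorem abs_sub_le_of_abs_deriv_le {f f' : ℝ → ℝ} {C t s : ℝ} (hs : 0 ≤ s) (ht : 0 ≤ t)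
    (hf : ∀ x, 0 ≤ x → HasDerivAt f (f' x) x) (hC : ∀ x ∈ uIcc s t, |f' x| ≤ C) :
    |f t - f s| ≤ C * |t - s| := by
  have := (convex_uIcc s t).norm_image_sub_le_of_norm_hasDerivWithin_le (f := f) (f' := f')
    (fun x hx => (hf x ((le_min hs ht).trans hx.1)).hasDerivWithinAt) hC
    left_mem_uIcc right_mem_uIcc
  simpa using this

theorem abs_kernel_le {b r t : ℝ} (hb : 0 ≤ b) (ht : 0 ≤ t) : |kernel b r t| ≤ t := by
  have := abs_sub_le_of_abs_deriv_le (C := 1) le_rfl ht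
    (fun x _ => hasDerivAt_kernel b r x) (fun x hx => abs_kernelDeriv_le hb
      (by rw [uIcc_of_le ht] at hx; exact hx.1))
  simpa [abs_of_nonneg ht] using this

/-- The primitive of `kernel`. -/
def kernelInt (b r t : ℝ) : ℝ := ∫ s in (0 : ℝ)..t, kernel b r s

theorem hasDerivAt_kernelInt (b r t : ℝ) : HasDerivAt (kernelInt b r) (kernel b r t) t :=
  (continuous_kernel b r).integral_hasStrictDerivAt 0 t |>.hasDerivAt

@[simp] theorem kernelInt_zero (b r : ℝ) : kernelInt b r 0 = 0 := by simp [kernelInt]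

/-- This is the oscillator equation integrated once in time. It is the mild formulation at one
frequency, and it bounds r²∫K although r² is unbounded. -/
theorem sq_mul_kernelInt (b r t : ℝ) :
    r ^ 2 * kernelInt b r t = 1 - kernelDeriv b r t - b * kernel b r t := by
  have hd : ∀ s, HasDerivAt
      (fun s => kernelDeriv b r s + b * kernel b r s + r ^ 2 * kernelInt b r s) 0 s := fun s => by
    convert! ((hasDerivAt_kernelDeriv b r s).add ((hasDerivAt_kernel b r s).const_mul b)).add
      ((hasDerivAt_kernelInt b r s).const_mul (r ^ 2)) using 1
    ring
  have := is_const_of_deriv_eq_zero (fun s => (hd s).differentiableAt) (fun s => (hd s).deriv) t 0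
  simp only [kernelDeriv_zero, kernel_zero, kernelInt_zero] at this
  linarith

theorem abs_kernelInt_le {b r t : ℝ} (hb : 0 ≤ b) (ht : 0 ≤ t) : |kernelInt b r t| ≤ t * t := by
  have := abs_sub_le_of_abs_deriv_le (C := t) le_rfl ht
    (fun x _ => hasDerivAt_kernelInt b r x) (fun x hx => by
      rw [uIcc_of_le ht] at hx; exact (abs_kernel_le hb hx.1).trans hx.2)
  simpa [abs_of_nonneg ht] using this

/-! ### Kernel and profile in the overdamped regime -/

/-- The kernel of the asymptotic profile. -/
def profileKernel (b r t : ℝ) : ℝ := Real.exp (-(r ^ 2 / b) * t) / b - Real.exp (-b * t) / b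

theorem one_sub_exp_neg_le (x : ℝ) : 1 - Real.exp (-x) ≤ x := by
  have := Real.add_one_le_exp (-x); linarith

theorem abs_exp_neg_sub_exp_neg_le {x y : ℝ} (h : x ≤ y) :
    |Real.exp (-x) - Real.exp (-y)| ≤ (y - x) * Real.exp (-x) := by
  have h1 : Real.exp (-y) = Real.exp (-x) * Real.exp (-(y - x)) := by
    rw [← Real.exp_add]; congr 1; ring
  rw [abs_of_nonneg (sub_nonneg.2 (Real.exp_le_exp.2 (by linarith))), h1]
  have := one_sub_exp_neg_le (y - x)
  nlinarith [Real.exp_pos (-x)]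

/-- Half of the exponential is spent on a factor that is linear in time. -/
theorem mul_exp_neg_le (x : ℝ) : x * Real.exp (-x) ≤ 2 * Real.exp (-(x / 2)) := by
  have h1 : Real.exp (-x) = Real.exp (-(x / 2)) * Real.exp (-(x / 2)) := by
    rw [← Real.exp_add]; congr 1; ring
  have h2 : x / 2 * Real.exp (-(x / 2)) ≤ 1 := by
    have h3 := Real.add_one_le_exp (x / 2)
    rw [Real.exp_neg]
    rw [← div_eq_mul_inv, div_le_one (Real.exp_pos _)]
    linarith
  rw [h1]
  nlinarith [Real.exp_pos (-(x / 2))]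

theorem kernel_eq_of_pos {b r q : ℝ} (hq : 0 < q) (hqq : q ^ 2 = b ^ 2 - 4 * r ^ 2) (t : ℝ) :
    kernel b r t
      = Real.exp (-((b - q) / 2 * t)) / q - Real.exp (-((b + q) / 2 * t)) / q := by
  have hD : b ^ 2 / 4 - r ^ 2 = (q / 2) ^ 2 := by linarith
  have hD0 : 0 < b ^ 2 / 4 - r ^ 2 := by rw [hD]; positivity
  have hs : √(b ^ 2 / 4 - r ^ 2) = q / 2 := by rw [hD]; exact Real.sqrt_sq (by positivity)
  have e1 : Real.exp (-((b - q) / 2 * t)) = Real.exp (-(b / 2) * t) * Real.exp (q / 2 * t) := by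
    rw [← Real.exp_add]; congr 1; ring
  have e2 : Real.exp (-((b + q) / 2 * t)) = Real.exp (-(b / 2) * t) * Real.exp (-(q / 2 * t)) := by
    rw [← Real.exp_add]; congr 1; ring
  rw [kernel, oscSine, if_pos hD0, hs, Real.sinh_eq, e1, e2]
  field_simp

section LowFrequency

variable {b r : ℝ}

/-- The discriminant bounds in the overdamped regime. -/
theorem exists_discriminant (hb : 0 < b) (h : 8 * r ^ 2 ≤ b ^ 2) :
    ∃ q, 0 < q ∧ q ^ 2 = b ^ 2 - 4 * r ^ 2 ∧ b / 2 ≤ q ∧ q ≤ b ∧ b - q ≤ 4 * (r ^ 2 / b) ∧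
      2 * (r ^ 2 / b) ≤ b - q := by
  have h0 : 0 ≤ b ^ 2 - 4 * r ^ 2 := by nlinarith [sq_nonneg r]
  have hqq := Real.sq_sqrt h0
  set q := √(b ^ 2 - 4 * r ^ 2) with hq
  have hq0 : 0 ≤ q := Real.sqrt_nonneg _
  have h1 : b / 2 ≤ q := by
    refine Real.le_sqrt_of_sq_le ?_
    nlinarith [sq_nonneg r]
  have h2 : q ≤ b := by
    rw [hq]; refine Real.sqrt_le_iff.2 ⟨hb.le, ?_⟩; nlinarith [sq_nonneg r]
  have hr : r ^ 2 / b * b = r ^ 2 := div_mul_cancel₀ _ hb.ne'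
  -- Since b ≤ b + q ≤ 2b, this product determines b - q up to a factor 2.
  have hmul : (b - q) * (b + q) = 4 * (r ^ 2 / b) * b := by rw [mul_assoc, hr]; linarith
  refine ⟨q, by linarith, hqq, h1, h2, ?_, ?_⟩
  · refine le_of_mul_le_mul_right (a := b) ?_ hb
    rw [← hmul]
    nlinarith
  · refine le_of_mul_le_mul_right (a := b) ?_ hb
    nlinarith

theorem abs_kernel_le_of_overdamped (hb : 0 < b) (h : 8 * r ^ 2 ≤ b ^ 2) {t : ℝ} (ht : 0 ≤ t) :
    |kernel b r t| ≤ 2 / b * Real.exp (-(r ^ 2 / b * t)) := by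
  obtain ⟨q, hq, hqq, h1, h2, h3, h4⟩ := exists_discriminant hb h
  rw [kernel_eq_of_pos hq hqq, ← sub_div, abs_div, abs_of_pos hq]
  have e1 : Real.exp (-((b - q) / 2 * t)) ≤ Real.exp (-(r ^ 2 / b * t)) := by
    apply Real.exp_le_exp.2; nlinarith
  have e2 : Real.exp (-((b + q) / 2 * t)) ≤ Real.exp (-((b - q) / 2 * t)) := by
    apply Real.exp_le_exp.2; nlinarith
  rw [abs_of_nonneg (by linarith)]
  have : 1 / q ≤ 2 / b := by
    rw [div_le_div_iff₀ hq hb]; linarith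
  calc _ ≤ Real.exp (-(r ^ 2 / b * t)) / q := by
        gcongr; have := Real.exp_pos (-((b + q) / 2 * t)); linarith
    _ = 1 / q * Real.exp (-(r ^ 2 / b * t)) := by ring
    _ ≤ _ := by gcongr

/-- With a = r²/b, the slow rate (b - q)/2 is compared with a, the fast rate (b + q)/2 with b, and
the prefactor 1/q with 1/b. Each comparison costs a relative error of order a/b once the factors of
t are absorbed into half of the exponential. -/
theorem abs_kernel_sub_profileKernel_le (hb : 0 < b) (h : 8 * r ^ 2 ≤ b ^ 2) {t : ℝ}
    (ht : 0 ≤ t) : |kernel b r t - profileKernel b r t|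
      ≤ 32 * (r ^ 2 / b ^ 3) * Real.exp (-(r ^ 2 / b * t / 2)) := by
  obtain ⟨q, hq, hqq, h1, h2, h3, h4⟩ := exists_discriminant hb h
  set a := r ^ 2 / b with ha
  have hab : a * b = r ^ 2 := div_mul_cancel₀ _ hb.ne'
  have ha0 : 0 ≤ a := by positivity
  have hab8 : 8 * a ≤ b := by
    refine le_of_mul_le_mul_right (a := b) ?_ hb
    rw [mul_assoc, hab]; nlinarith
  have hinv : |1 / q - 1 / b| ≤ 8 * (a / b ^ 2) := by
    rw [abs_of_nonneg (sub_nonneg.2 (one_div_le_one_div_of_le hq h2)),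
      div_sub_div _ _ hq.ne' hb.ne', ← mul_div_assoc,
      div_le_div_iff₀ (by positivity) (by positivity)]
    have : (1 * b - q * 1) * b ≤ 4 * a * (2 * q) := by
      simp only [one_mul, mul_one]
      exact mul_le_mul h3 (by linarith) hb.le (by positivity)
    nlinarith
  have hE := Real.exp_pos (-(a * t / 2))
  -- the slow mode
  have s1 : Real.exp (-((b - q) / 2 * t)) ≤ Real.exp (-(a * t / 2)) := by
    apply Real.exp_le_exp.2; nlinarith
  have s2 : |Real.exp (-((b - q) / 2 * t)) - Real.exp (-(a * t))|
      ≤ 8 * (a / b) * Real.exp (-(a * t / 2)) := by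
    rw [abs_sub_comm]
    refine (abs_exp_neg_sub_exp_neg_le (by nlinarith)).trans ?_
    -- The defect of the slow rate is of second order in a, because (b - q - 2a)(b + q) = 2a(b - q).
    -- The spare factor a pairs with t.
    have k1 : (b - q) / 2 - a ≤ 4 * (a / b) * a := by
      have k2 : (b - q - 2 * a) * (b * b) ≤ 8 * (a * a) * b := by
        have k3 : (b - q) * (b + q) = 4 * (a * b) := by rw [hab]; linarith
        have k4 : (b - q - 2 * a) * (b + q) = 2 * a * (b - q) := by linear_combination k3
        have k5 : (b - q - 2 * a) * b ≤ 2 * a * (b - q) := by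
          rw [← k4]; exact mul_le_mul_of_nonneg_left (by linarith) (by linarith)
        calc _ = (b - q - 2 * a) * b * b := by ring
          _ ≤ 2 * a * (4 * a) * b :=
            mul_le_mul_of_nonneg_right (k5.trans (by gcongr)) hb.le
          _ = _ := by ring
      have k6 : b - q - 2 * a ≤ 8 * (a * a) * b / (b * b) := (le_div_iff₀ (by positivity)).2 k2
      have k7 : 8 * (a * a) * b / (b * b) = 8 * (a / b) * a := by field_simp
      linarith
    calc ((b - q) / 2 * t - a * t) * Real.exp (-(a * t))
        = ((b - q) / 2 - a) * t * Real.exp (-(a * t)) := by ring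
      _ ≤ 4 * (a / b) * a * t * Real.exp (-(a * t)) := by gcongr
      _ = 4 * (a / b) * (a * t * Real.exp (-(a * t))) := by ring
      _ ≤ 4 * (a / b) * (2 * Real.exp (-(a * t / 2))) :=
        mul_le_mul_of_nonneg_left (mul_exp_neg_le _) (by positivity)
      _ = _ := by ring
  -- the fast mode
  have f1 : Real.exp (-((b + q) / 2 * t)) ≤ Real.exp (-(a * t / 2)) := by
    apply Real.exp_le_exp.2; nlinarith
  have f2 : |Real.exp (-((b + q) / 2 * t)) - Real.exp (-(b * t))|
      ≤ 8 * (a / b) * Real.exp (-(a * t / 2)) := by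
    refine (abs_exp_neg_sub_exp_neg_le (by nlinarith)).trans ?_
    -- Here the defect is only of first order in a, but t comes with the rate b/2, so the faster
    -- exponential absorbs it.
    have k1 : (b * t - (b + q) / 2 * t) ≤ 4 * (a / b) * (b / 2 * t) := by
      have : 4 * (a / b) * (b / 2 * t) = 2 * a * t := by field_simp; ring
      rw [this]; nlinarith
    calc (b * t - (b + q) / 2 * t) * Real.exp (-((b + q) / 2 * t))
        ≤ 4 * (a / b) * (b / 2 * t) * Real.exp (-(b / 2 * t)) := by
          gcongr
          nlinarith
      _ = 4 * (a / b) * (b / 2 * t * Real.exp (-(b / 2 * t))) := by ring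
      _ ≤ 4 * (a / b) * (2 * Real.exp (-(b / 2 * t / 2))) :=
        mul_le_mul_of_nonneg_left (mul_exp_neg_le _) (by positivity)
      _ ≤ 4 * (a / b) * (2 * Real.exp (-(a * t / 2))) := by
        gcongr; nlinarith
      _ = _ := by ring
  have key : ∀ x y : ℝ, 0 ≤ x → x ≤ Real.exp (-(a * t / 2)) →
      |x - y| ≤ 8 * (a / b) * Real.exp (-(a * t / 2)) →
      |x / q - y / b| ≤ 16 * (a / b ^ 2) * Real.exp (-(a * t / 2)) := by
    intro x y hx hxE hxy
    calc |x / q - y / b| = |x * (1 / q - 1 / b) + (x - y) / b| := by congr 1; ring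
      _ ≤ |x| * |1 / q - 1 / b| + |x - y| / b := by
        refine (abs_add_le _ _).trans ?_
        rw [abs_mul, abs_div, abs_of_pos hb]
      _ ≤ Real.exp (-(a * t / 2)) * (8 * (a / b ^ 2))
          + 8 * (a / b) * Real.exp (-(a * t / 2)) / b := by
        rw [abs_of_nonneg hx]; gcongr
      _ = _ := by field_simp; ring
  have e : r ^ 2 / b ^ 3 = a / b ^ 2 := by rw [ha]; field_simp
  rw [kernel_eq_of_pos hq hqq, profileKernel, e, neg_mul, neg_mul]
  calc _ = |(Real.exp (-((b - q) / 2 * t)) / q - Real.exp (-(a * t)) / b)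
        - (Real.exp (-((b + q) / 2 * t)) / q - Real.exp (-(b * t)) / b)| := by congr 1; ring
    _ ≤ _ := abs_sub _ _
    _ ≤ _ := add_le_add (key _ _ (Real.exp_pos _).le s1 s2) (key _ _ (Real.exp_pos _).le f1 f2)
    _ = _ := by ring

/-- The two terms cancel to first order, which removes the singularity 1/b. Estimated separately
they need not be square integrable near the zero frequency. -/
theorem abs_profileKernel_le_of_overdamped (hb : 0 < b) (h : 8 * r ^ 2 ≤ b ^ 2) {t : ℝ}
    (ht : 0 ≤ t) : |profileKernel b r t| ≤ t := by
  have hab : r ^ 2 / b ≤ b := by rw [div_le_iff₀ hb]; nlinarith [sq_nonneg r]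
  have ha0 : 0 ≤ r ^ 2 / b := by positivity
  rw [profileKernel, ← sub_div, abs_div, abs_of_pos hb, div_le_iff₀ hb, neg_mul, neg_mul]
  refine (abs_exp_neg_sub_exp_neg_le (by gcongr)).trans ?_
  have : Real.exp (-(r ^ 2 / b * t)) ≤ 1 := Real.exp_le_one_iff.2 (by simp; positivity)
  calc _ ≤ (b * t - r ^ 2 / b * t) * 1 := by
        gcongr
        have := mul_le_mul_of_nonneg_right hab ht
        linarith
    _ ≤ _ := by nlinarith [mul_nonneg ha0 ht]

end LowFrequency

/-! ### Kernel and profile away from the zero frequency -/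

theorem abs_oscSine_le_of_nonpos {D t : ℝ} (hD : D ≤ 0) (ht : 0 ≤ t) : |oscSine D t| ≤ t := by
  have := abs_sub_le_of_abs_deriv_le (C := 1) le_rfl ht
    (fun x _ => hasDerivAt_oscSine D x) (fun x _ => by
      rw [oscCosine, if_neg hD.not_gt]; exact Real.abs_cos_le_one _)
  simpa [abs_of_nonneg ht, oscSine] using this

theorem abs_oscSine_le_of_pos {D t : ℝ} (hD : 0 < D) (ht : 0 ≤ t) :
    |oscSine D t| ≤ t * Real.exp (√D * t) := by
  have := abs_sub_le_of_abs_deriv_le (C := Real.exp (√D * t)) le_rfl ht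
    (fun x _ => hasDerivAt_oscSine D x) (fun x hx => by
      rw [uIcc_of_le ht] at hx
      rw [oscCosine, if_pos hD, abs_of_pos (Real.cosh_pos _), Real.cosh_eq]
      have h0 : 0 ≤ √D := Real.sqrt_nonneg D
      have h1 : Real.exp (√D * x) ≤ Real.exp (√D * t) :=
        Real.exp_le_exp.2 (mul_le_mul_of_nonneg_left hx.2 h0)
      have h2 : Real.exp (-(√D * x)) ≤ Real.exp (√D * t) :=
        Real.exp_le_exp.2 (by nlinarith [mul_nonneg h0 hx.1, mul_nonneg h0 ht])
      linarith)
  simpa [abs_of_nonneg ht, oscSine, mul_comm] using this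

section HighFrequency

variable {b r c : ℝ}

/-- The decay rate is b/2 without real distinct roots, and otherwise b/2 - √(b²/4 - r²) ≥ cb because
b²/4 - cb² ≤ (b/2 - cb)². The factor t makes the bound uniform across the double root. -/
theorem abs_kernel_le_of_mul_sq_le (hb : 0 < b) (hc : c ≤ 1 / 2) (h : c * b ^ 2 ≤ r ^ 2)
    {t : ℝ} (ht : 0 ≤ t) : |kernel b r t| ≤ t * Real.exp (-(c * b * t)) := by
  rw [kernel, abs_mul, abs_of_pos (Real.exp_pos _)]
  rcases le_or_gt (b ^ 2 / 4 - r ^ 2) 0 with hD | hD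
  · rw [mul_comm]
    refine mul_le_mul (abs_oscSine_le_of_nonpos hD ht) ?_ (Real.exp_pos _).le ht
    apply Real.exp_le_exp.2
    nlinarith [mul_nonneg hb.le ht]
  · calc _ ≤ Real.exp (-(b / 2) * t) * (t * Real.exp (√(b ^ 2 / 4 - r ^ 2) * t)) := by
          gcongr; exact abs_oscSine_le_of_pos hD ht
      _ = t * Real.exp (-((b / 2 - √(b ^ 2 / 4 - r ^ 2)) * t)) := by
        rw [mul_left_comm, ← Real.exp_add]; ring_nf
      _ ≤ _ := by
        have hs : √(b ^ 2 / 4 - r ^ 2) ≤ b / 2 - c * b := by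
          refine Real.sqrt_le_iff.2 ⟨by nlinarith, ?_⟩
          nlinarith [mul_nonneg (sq_nonneg c) (sq_nonneg b)]
        gcongr
        linarith

theorem abs_profileKernel_le_of_mul_sq_le (hb : 0 < b) (hc : c ≤ 1 / 2) (h : c * b ^ 2 ≤ r ^ 2)
    {t : ℝ} (ht : 0 ≤ t) : |profileKernel b r t| ≤ 1 / b * Real.exp (-(c * b * t)) := by
  have h1 : c * b ≤ r ^ 2 / b := by rw [le_div_iff₀ hb]; nlinarith
  have e1 : Real.exp (-(r ^ 2 / b) * t) ≤ Real.exp (-(c * b * t)) := by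
    apply Real.exp_le_exp.2; nlinarith
  have e2 : Real.exp (-b * t) ≤ Real.exp (-(c * b * t)) := by
    apply Real.exp_le_exp.2; nlinarith [mul_nonneg hb.le ht]
  rw [profileKernel, ← sub_div, abs_div, abs_of_pos hb, div_eq_mul_one_div, mul_comm]
  gcongr
  rw [abs_le]
  constructor <;> linarith [Real.exp_pos (-(r ^ 2 / b) * t), Real.exp_pos (-b * t)]

end HighFrequency

/-! ### The L² Fourier transform and its normalization -/

/-- On `L¹ ∩ L²` the Fourier transform of `L²` is given by the Fourier integral. -/
theorem fourier_toLp_ae_eq {n : ℕ} {f : Space n → ℂ} (h1 : Integrable f) (h2 : MemLp f 2 volume) :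
    (𝓕 (h2.toLp f) : L2 n) =ᵐ[volume] 𝓕 f := by
  have hcont : Continuous (𝓕 f : Space n → ℂ) :=
    VectorFourier.fourierIntegral_continuous Real.continuous_fourierChar
      (by exact continuous_inner) h1
  -- Both transforms are tested against smooth compactly supported functions: the L² one moves onto
  -- the test function by its definition on tempered distributions, the integral one by Fubini.
  refine ae_eq_of_integral_contDiff_smul_eq
    ((Lp.memLp _).locallyIntegrable (by norm_num)) hcont.locallyIntegrable ?_
  intro g hg hgc
  have hg1 : HasCompactSupport (Complex.ofRealCLM ∘ g) := hgc.comp_left rfl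
  have hg2 : ContDiff ℝ ∞ (Complex.ofRealCLM ∘ g) := by fun_prop
  set φ : 𝓢(Space n, ℂ) := hg1.toSchwartzMap hg2 with hφ
  have hφg : ∀ x, φ x = (g x : ℂ) := fun x => rfl
  have h := congrArg (fun T => T φ) (Lp.fourier_toTemperedDistribution_eq (h2.toLp f))
  simp only [TemperedDistribution.fourier_apply, Lp.toTemperedDistribution_apply] at h
  have e1 : ∀ F : Space n → ℂ, ∫ x, g x • F x = ∫ x, φ x • F x := fun F => by
    simp [hφg]
  rw [e1, e1, ← h]
  have e2 : ∫ x, (𝓕 φ) x • (h2.toLp f) x = ∫ x, (𝓕 φ) x • f x := by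
    refine integral_congr_ae ?_
    filter_upwards [h2.coeFn_toLp] with x hx
    rw [hx]
  rw [e2]
  have := VectorFourier.integral_fourierIntegral_smul_eq_flip (μ := (volume : Measure (Space n)))
    (ν := (volume : Measure (Space n))) (L := innerₗ (Space n)) Real.continuous_fourierChar
    (by exact continuous_inner) φ.integrable h1
  rw [flip_innerₗ] at this
  exact this

section Dilation

variable {n : ℕ}

theorem ae_comp_smul {p : Space n → Prop} (h : ∀ᵐ ξ, p ξ) {c : ℝ} (hc : c ≠ 0) :
    ∀ᵐ η : Space n, p (c • η) := by
  have hq : Measure.QuasiMeasurePreserving (fun η : Space n => c • η) volume volume := by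
    refine ⟨by fun_prop, ?_⟩
    rw [Measure.map_addHaar_smul _ hc]
    exact Measure.smul_absolutelyContinuous
  exact hq.ae h

theorem isMultiplier_iff {m : Space n → ℝ} {f g : L2 n} :
    IsMultiplier m f g ↔
      (𝓕 g : L2 n) =ᵐ[volume] fun η => (m ((2 * Real.pi) • η) : ℂ) * (𝓕 f : L2 n) η := by
  have hc : (2 * Real.pi) ≠ 0 := by positivity
  constructor
  · intro h
    filter_upwards [ae_comp_smul h hc] with η hη
    simpa only [hat, smul_smul, inv_mul_cancel₀ hc, one_smul] using hη
  · intro h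
    filter_upwards [ae_comp_smul h (inv_ne_zero hc)] with η hη
    simpa only [hat, smul_smul, mul_inv_cancel₀ hc, one_smul] using hη

end Dilation

/-! ### Families of multiplication operators on L² -/

section Multiplication

variable {n : ℕ}

theorem norm_sq_eq_integral (f : L2 n) : ‖f‖ ^ 2 = ∫ η, ‖f η‖ ^ 2 := by
  have h := MeasureTheory.L2.inner_def (𝕜 := ℂ) f f
  rw [inner_self_eq_norm_sq_to_K] at h
  have h2 : ∀ η, inner ℂ (f η) (f η) = ((‖f η‖ ^ 2 : ℝ) : ℂ) := fun η => by
    rw [inner_self_eq_norm_sq_to_K]; simp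
  simp_rw [h2] at h
  rw [integral_complex_ofReal] at h
  exact Complex.ofReal_injective (by simpa using h)

/-- Multiplication of an element of `L²` by a bounded real function. -/
def mulLp (k : Space n → ℝ) (f : L2 n) : L2 n :=
  open Classical in
  -- The default 0 lets families such as t ↦ k_t be formed without carrying bounds; it is never met
  -- when k is essentially bounded.
  if h : MemLp (fun η => (k η : ℂ) * f η) 2 volume then h.toLp _ else 0

variable {k : Space n → ℝ} {C : ℝ}

theorem coeFn_mulLp (hk : AEStronglyMeasurable k) (hC : ∀ᵐ η, |k η| ≤ C) (f : L2 n) :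
    mulLp k f =ᵐ[volume] fun η => (k η : ℂ) * f η := by
  have h : MemLp (fun η => (k η : ℂ) * f η) 2 volume := by
    refine (Lp.memLp f).of_le_mul (c := C)
      ((Complex.continuous_ofReal.comp_aestronglyMeasurable hk).mul (Lp.aestronglyMeasurable f)) ?_
    filter_upwards [hC] with η hη
    rw [norm_mul, Complex.norm_real, Real.norm_eq_abs]
    gcongr
  rw [mulLp, dif_pos h]
  exact h.coeFn_toLp

theorem norm_mulLp_le (hk : AEStronglyMeasurable k) (hC : ∀ᵐ η, |k η| ≤ C) (f : L2 n) :
    ‖mulLp k f‖ ≤ C * ‖f‖ := by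
  refine Lp.norm_le_mul_norm_of_ae_le_mul ?_
  filter_upwards [hC, coeFn_mulLp hk hC f] with η hη hf
  rw [hf, norm_mul, Complex.norm_real, Real.norm_eq_abs]
  gcongr

/-- Multiplication by a bounded function as an operator in `L²`. -/
def mulCLM (k : Space n → ℝ) (C : ℝ) (hk : AEStronglyMeasurable k) (hC : ∀ᵐ η, |k η| ≤ C) :
    L2 n →L[ℂ] L2 n :=
  LinearMap.mkContinuous
    { toFun := mulLp k
      map_add' := fun f g => by
        refine Lp.ext ?_
        filter_upwards [coeFn_mulLp hk hC (f + g), coeFn_mulLp hk hC f, coeFn_mulLp hk hC g,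
          Lp.coeFn_add f g, Lp.coeFn_add (mulLp k f) (mulLp k g)] with η h1 h2 h3 h4 h5
        rw [h1, h5, h4, Pi.add_apply, Pi.add_apply, h2, h3, mul_add]
      map_smul' := fun c f => by
        refine Lp.ext ?_
        filter_upwards [coeFn_mulLp hk hC (c • f), coeFn_mulLp hk hC f,
          Lp.coeFn_smul c f, Lp.coeFn_smul c (mulLp k f)] with η h1 h2 h3 h4
        simp only [RingHom.id_apply]
        rw [h1, h4, h3, Pi.smul_apply, Pi.smul_apply, h2, smul_eq_mul, smul_eq_mul, mul_left_comm] }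
    C (norm_mulLp_le hk hC)

/-- Dominated convergence for the squared norm of the difference, with majorant (2C)²|f|². -/
theorem tendsto_mulLp {ι : Type*} {l : Filter ι} [l.IsCountablyGenerated] {κ : ι → Space n → ℝ}
    (hκ : ∀ i, AEStronglyMeasurable (κ i)) (hk : AEStronglyMeasurable k)
    (hκC : ∀ᶠ i in l, ∀ᵐ η, |κ i η| ≤ C) (hkC : ∀ᵐ η, |k η| ≤ C)
    (hlim : ∀ᵐ η, Tendsto (fun i => κ i η) l (𝓝 (k η))) (f : L2 n) :
    Tendsto (fun i => mulLp (κ i) f) l (𝓝 (mulLp k f)) := by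
  have hsq : Tendsto (fun i => ‖mulLp (κ i) f - mulLp k f‖ ^ 2) l (𝓝 0) := by
    have e : (fun i => ‖mulLp (κ i) f - mulLp k f‖ ^ 2)
        =ᶠ[l] fun i => ∫ η, (κ i η - k η) ^ 2 * ‖f η‖ ^ 2 := by
      filter_upwards [hκC] with i hi
      rw [norm_sq_eq_integral]
      refine integral_congr_ae ?_
      filter_upwards [coeFn_mulLp (hκ i) hi f, coeFn_mulLp hk hkC f,
        Lp.coeFn_sub (mulLp (κ i) f) (mulLp k f)] with η h1 h2 h3
      rw [h3, Pi.sub_apply, h1, h2, ← sub_mul, norm_mul, mul_pow, ← Complex.ofReal_sub,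
        Complex.norm_real, Real.norm_eq_abs, sq_abs]
    refine Tendsto.congr' e.symm ?_
    have hf2 : Integrable (fun η => ‖f η‖ ^ 2) := (Lp.memLp f).integrable_norm_pow (by norm_num)
    have := tendsto_integral_filter_of_dominated_convergence (μ := volume) (l := l)
      (F := fun i η => (κ i η - k η) ^ 2 * ‖f η‖ ^ 2) (f := fun _ => (0 : ℝ))
      (fun η => (2 * C) ^ 2 * ‖f η‖ ^ 2)
      (Eventually.of_forall fun i => (((hκ i).sub hk).pow 2).mul hf2.aestronglyMeasurable)
      ?_ (hf2.const_mul _) ?_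
    · simpa using this
    · filter_upwards [hκC] with i hi
      filter_upwards [hi, hkC] with η h1 h2
      rw [norm_mul, norm_pow, norm_pow, norm_norm, Real.norm_eq_abs]
      gcongr
      exact (abs_sub _ _).trans (by linarith)
    · filter_upwards [hlim] with η hη
      have h0 : Tendsto (fun i => κ i η - k η) l (𝓝 0) := by
        simpa using hη.sub_const (k η)
      simpa using (h0.pow 2).mul_const (‖f η‖ ^ 2)
  rw [tendsto_iff_norm_sub_tendsto_zero]
  have := hsq.sqrt
  simpa [Real.sqrt_sq (norm_nonneg _)] using this

theorem continuousOn_mulLp {κ : ℝ → Space n → ℝ} {M : ℝ → ℝ}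
    (hκ : ∀ t, AEStronglyMeasurable (κ t)) (hM : MonotoneOn M (Ici 0))
    (hb : ∀ᵐ η, ∀ t, 0 ≤ t → |κ t η| ≤ M t) (hc : ∀ᵐ η, Continuous fun t => κ t η) (f : L2 n) :
    ContinuousOn (fun t => mulLp (κ t) f) (Ici 0) := by
  intro t ht
  have ht' : (0 : ℝ) ≤ t := ht
  have hmem : ∀ᶠ s in 𝓝[Ici 0] t, s ∈ Icc 0 (t + 1) := by
    filter_upwards [self_mem_nhdsWithin,
      mem_nhdsWithin_of_mem_nhds (Iic_mem_nhds (show t < t + 1 by linarith))] with s h1 h2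
    exact ⟨h1, h2⟩
  have hbd : ∀ s ∈ Icc 0 (t + 1), ∀ᵐ η, |κ s η| ≤ M (t + 1) := fun s hs => by
    filter_upwards [hb] with η hη
    exact (hη s hs.1).trans (hM hs.1 (show (0 : ℝ) ≤ t + 1 by linarith) hs.2)
  refine tendsto_mulLp (C := M (t + 1)) hκ (hκ t) ?_ (hbd t ⟨ht', by linarith⟩) ?_ f
  · filter_upwards [hmem] with s hs using hbd s hs
  · filter_upwards [hc] with η hη
    exact hη.continuousAt.continuousWithinAt

/-- The mean value inequality bounds the difference quotients near t by M(t + 1), so `tendsto_mulLp`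
applies to them. The bound B only ensures that the products themselves lie in L². -/
theorem hasDerivWithinAt_mulLp {κ κ' : ℝ → Space n → ℝ} {M : ℝ → ℝ} {B : ℝ → ℝ}
    (hκ : ∀ t, AEStronglyMeasurable (κ t)) (hκ' : ∀ t, AEStronglyMeasurable (κ' t))
    (hM : MonotoneOn M (Ici 0)) (hB : ∀ᵐ η, ∀ t, 0 ≤ t → |κ t η| ≤ B t)
    (hb : ∀ᵐ η, ∀ t, 0 ≤ t → |κ' t η| ≤ M t)
    (hd : ∀ᵐ η, ∀ t, HasDerivAt (fun t => κ t η) (κ' t η) t) (f : L2 n) {t : ℝ} (ht : 0 ≤ t) :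
    HasDerivWithinAt (fun t => mulLp (κ t) f) (mulLp (κ' t) f) (Ici 0) t := by
  rw [hasDerivWithinAt_iff_tendsto_slope]
  have hmem : ∀ᶠ s in 𝓝[Ici 0 \ {t}] t, s ∈ Icc 0 (t + 1) ∧ s ≠ t := by
    filter_upwards [self_mem_nhdsWithin,
      mem_nhdsWithin_of_mem_nhds (Iic_mem_nhds (show t < t + 1 by linarith))] with s h1 h2
    exact ⟨⟨h1.1, h2⟩, h1.2⟩
  have hBt : ∀ s, 0 ≤ s → ∀ᵐ η, |κ s η| ≤ B s := fun s hs => by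
    filter_upwards [hB] with η hη using hη s hs
  have hm : ∀ s, AEStronglyMeasurable (fun η => slope (fun t => κ t η) t s) := fun s => by
    simp only [slope_def_field, div_eq_mul_inv]
    exact ((hκ s).sub (hκ t)).mul_const _
  have hbd : ∀ s ∈ Icc 0 (t + 1), s ≠ t →
      ∀ᵐ η, |slope (fun t => κ t η) t s| ≤ M (t + 1) := fun s hs hst => by
    filter_upwards [hb, hd] with η h1 h2
    rw [slope_def_field, abs_div, div_le_iff₀ (abs_pos.2 (sub_ne_zero.2 hst))]
    refine abs_sub_le_of_abs_deriv_le ht hs.1 (fun x _ => h2 x) fun x hx => ?_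
    have hx0 : 0 ≤ x := (le_min ht hs.1).trans hx.1
    exact (h1 x hx0).trans (hM hx0 (show (0 : ℝ) ≤ t + 1 by linarith)
      (hx.2.trans (max_le (by linarith) hs.2)))
  have hlim : Tendsto (fun s => mulLp (fun η => slope (fun t => κ t η) t s) f)
      (𝓝[Ici 0 \ {t}] t) (𝓝 (mulLp (κ' t) f)) := by
    refine tendsto_mulLp (C := M (t + 1)) hm (hκ' t) ?_ ?_ ?_ f
    · filter_upwards [hmem] with s hs using hbd s hs.1 hs.2
    · filter_upwards [hb] with η h1
      exact (h1 t ht).trans (hM ht (show (0 : ℝ) ≤ t + 1 by linarith) (by linarith))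
    · filter_upwards [hd] with η h1
      exact hasDerivWithinAt_iff_tendsto_slope.1 (h1 t).hasDerivWithinAt
  refine hlim.congr' ?_
  filter_upwards [hmem] with s hs
  rw [slope_def_module]
  refine Lp.ext ?_
  filter_upwards [coeFn_mulLp (hm s) (hbd s hs.1 hs.2) f, coeFn_mulLp (hκ s) (hBt s hs.1.1) f,
    coeFn_mulLp (hκ t) (hBt t ht) f, Lp.coeFn_sub (mulLp (κ s) f) (mulLp (κ t) f),
    Lp.coeFn_smul (s - t)⁻¹ (mulLp (κ s) f - mulLp (κ t) f)] with η h1 h2 h3 h4 h5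
  rw [h1, h5, Pi.smul_apply, h4, Pi.sub_apply, h2, h3, slope_def_field, Complex.real_smul]
  push_cast
  rw [div_eq_inv_mul]
  ring

end Multiplication

/-! ### Measurability and elementary bounds of the symbols -/

section Measurability

theorem measurable_oscSine : Measurable fun p : ℝ × ℝ => oscSine p.1 p.2 := by
  refine Measurable.ite (measurableSet_lt measurable_const measurable_fst) (by fun_prop) ?_
  exact Measurable.ite (measurableSet_lt measurable_fst measurable_const) (by fun_prop)
    measurable_snd

theorem measurable_oscCosine : Measurable fun p : ℝ × ℝ => oscCosine p.1 p.2 :=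
  Measurable.ite (measurableSet_lt measurable_const measurable_fst) (by fun_prop) (by fun_prop)

variable {α : Type*} [MeasurableSpace α] {b r t : α → ℝ}

theorem measurable_kernel (hb : Measurable b) (hr : Measurable r) (ht : Measurable t) :
    Measurable fun x => kernel (b x) (r x) (t x) := by
  have h : Measurable fun x => oscSine (b x ^ 2 / 4 - r x ^ 2) (t x) :=
    measurable_oscSine.comp
      (f := fun x => (b x ^ 2 / 4 - r x ^ 2, t x)) (by fun_prop)
  unfold kernel
  fun_prop

theorem measurable_kernelDeriv (hb : Measurable b) (hr : Measurable r) (ht : Measurable t) :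
    Measurable fun x => kernelDeriv (b x) (r x) (t x) := by
  have h : Measurable fun x => oscSine (b x ^ 2 / 4 - r x ^ 2) (t x) :=
    measurable_oscSine.comp
      (f := fun x => (b x ^ 2 / 4 - r x ^ 2, t x)) (by fun_prop)
  have h' : Measurable fun x => oscCosine (b x ^ 2 / 4 - r x ^ 2) (t x) :=
    measurable_oscCosine.comp
      (f := fun x => (b x ^ 2 / 4 - r x ^ 2, t x)) (by fun_prop)
  unfold kernelDeriv
  fun_prop

theorem measurable_kernelInt (hb : Measurable b) (hr : Measurable r) (t : ℝ) :
    Measurable fun x => kernelInt (b x) (r x) t := by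
  have h : StronglyMeasurable fun p : α × ℝ => kernel (b p.1) (r p.1) p.2 :=
    (measurable_kernel (hb.comp measurable_fst) (hr.comp measurable_fst)
      measurable_snd).stronglyMeasurable
  unfold kernelInt intervalIntegral
  exact (h.integral_prod_right (ν := volume.restrict (Ioc 0 t))).measurable.sub
    (h.integral_prod_right (ν := volume.restrict (Ioc t 0))).measurable

end Measurability

section Symbol

variable {n : ℕ} {θ : ℝ}

theorem measurable_logSymbol : Measurable (logSymbol θ : Space n → ℝ) := by
  unfold logSymbol; fun_prop

theorem logSymbol_nonneg (ξ : Space n) : 0 ≤ logSymbol θ ξ :=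
  Real.log_nonneg (by have := Real.rpow_nonneg (norm_nonneg ξ) (2 * θ); linarith)

theorem logSymbol_le_rpow (ξ : Space n) : logSymbol θ ξ ≤ ‖ξ‖ ^ (2 * θ) := by
  have h := Real.rpow_nonneg (norm_nonneg ξ) (2 * θ)
  have := Real.log_le_sub_one_of_pos (show 0 < 1 + ‖ξ‖ ^ (2 * θ) by linarith)
  unfold logSymbol; linarith

/-- For θ ≤ 1/2 the damping is weaker than one derivative, so the energy controls it. -/
theorem logSymbol_le_one_add (h0 : 0 < θ) (h1 : θ ≤ 1 / 2) (ξ : Space n) :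
    logSymbol θ ξ ≤ 1 + ‖ξ‖ := by
  refine (logSymbol_le_rpow ξ).trans ?_
  rcases le_total ‖ξ‖ 1 with h | h
  · have := Real.rpow_le_one (norm_nonneg ξ) h (show 0 ≤ 2 * θ by linarith)
    linarith [norm_nonneg ξ]
  · have := Real.rpow_le_rpow_of_exponent_le h (show 2 * θ ≤ 1 by linarith)
    rw [Real.rpow_one] at this
    linarith

end Symbol

/-! ### Bounded Fourier multipliers -/

section FourierMultiplier

variable {n : ℕ}

/-- The Fourier multiplier operator with a bounded real symbol. -/
def fourierMul (k : Space n → ℝ) (f : L2 n) : L2 n :=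
  (Lp.fourierTransformₗᵢ (Space n) ℂ).symm (mulLp (fun η => k ((2 * Real.pi) • η)) (𝓕 f))

theorem fourier_fourierMul (k : Space n → ℝ) (f : L2 n) :
    (𝓕 (fourierMul k f) : L2 n) = mulLp (fun η => k ((2 * Real.pi) • η)) (𝓕 f) :=
  (Lp.fourierTransformₗᵢ (Space n) ℂ).apply_symm_apply _

theorem measurable_dilate {k : Space n → ℝ} (hk : Measurable k) :
    AEStronglyMeasurable (fun η : Space n => k ((2 * Real.pi) • η)) :=
  (hk.comp (measurable_const_smul _)).aestronglyMeasurable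

theorem coeFn_fourier_fourierMul {k : Space n → ℝ} (hk : Measurable k) {C : ℝ}
    (hC : ∀ ξ, |k ξ| ≤ C) (f : L2 n) : (𝓕 (fourierMul k f) : L2 n) =ᵐ[volume]
      fun η => (k ((2 * Real.pi) • η) : ℂ) * (𝓕 f : L2 n) η := by
  rw [fourier_fourierMul]
  exact coeFn_mulLp (measurable_dilate hk) (Eventually.of_forall fun η => hC _) _

theorem isMultiplier_fourierMul {m k k' : Space n → ℝ} (hk : Measurable k) (hk' : Measurable k')
    {C C' : ℝ} (hC : ∀ ξ, |k ξ| ≤ C) (hC' : ∀ ξ, |k' ξ| ≤ C') (h : ∀ ξ, k' ξ = m ξ * k ξ)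
    (f : L2 n) : IsMultiplier m (fourierMul k f) (fourierMul k' f) := by
  rw [isMultiplier_iff]
  filter_upwards [coeFn_fourier_fourierMul hk hC f, coeFn_fourier_fourierMul hk' hC' f]
    with η h1 h2
  rw [h1, h2, h]
  push_cast
  ring

theorem fourier_injective {f g : L2 n} (h : (𝓕 f : L2 n) =ᵐ[volume] (𝓕 g : L2 n)) : f = g :=
  (Lp.fourierTransformₗᵢ (Space n) ℂ).injective (Lp.ext h)

theorem continuousOn_fourierMul {κ : ℝ → Space n → ℝ} {M : ℝ → ℝ}
    (hκ : ∀ t, Measurable (κ t)) (hM : MonotoneOn M (Ici 0))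
    (hb : ∀ ξ t, 0 ≤ t → |κ t ξ| ≤ M t) (hc : ∀ ξ, Continuous fun t => κ t ξ) (f : L2 n) :
    ContinuousOn (fun t => fourierMul (κ t) f) (Ici 0) :=
  (Lp.fourierTransformₗᵢ (Space n) ℂ).symm.continuous.comp_continuousOn
    (continuousOn_mulLp (fun t => measurable_dilate (hκ t)) hM
      (Eventually.of_forall fun _ => hb _) (Eventually.of_forall fun _ => hc _) _)

theorem hasDerivWithinAt_fourierMul {κ κ' : ℝ → Space n → ℝ} {M B : ℝ → ℝ}
    (hκ : ∀ t, Measurable (κ t)) (hκ' : ∀ t, Measurable (κ' t))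
    (hM : MonotoneOn M (Ici 0)) (hB : ∀ ξ t, 0 ≤ t → |κ t ξ| ≤ B t)
    (hb : ∀ ξ t, 0 ≤ t → |κ' t ξ| ≤ M t)
    (hd : ∀ ξ t, HasDerivAt (fun t => κ t ξ) (κ' t ξ) t) (f : L2 n) {t : ℝ} (ht : 0 ≤ t) :
    HasDerivWithinAt (fun t => fourierMul (κ t) f) (fourierMul (κ' t) f) (Ici 0) t :=
  (((Lp.fourierTransformₗᵢ (Space n) ℂ).symm.toContinuousLinearEquiv :
    L2 n →L[ℂ] L2 n).restrictScalars ℝ).hasFDerivAt.comp_hasDerivWithinAt t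
    (hasDerivWithinAt_mulLp (fun t => measurable_dilate (hκ t)) (fun t => measurable_dilate (hκ' t))
      hM (Eventually.of_forall fun _ => hB _) (Eventually.of_forall fun _ => hb _)
      (Eventually.of_forall fun _ => hd _) _ ht)

end FourierMultiplier

/-! ### Existence of the mild solution -/

section Existence

variable {n : ℕ} {θ : ℝ}

/-- The solution operator applied to the initial velocity. -/
def solution (θ : ℝ) (f : L2 n) (t : ℝ) : L2 n :=
  fourierMul (fun ξ => kernel (logSymbol θ ξ) ‖ξ‖ t) f

theorem mul_abs_kernel_le_one_add {b r t c : ℝ} (hb : 0 ≤ b) (hr : 0 ≤ r) (ht : 0 ≤ t)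
    (hc : c ≤ 1 + r) : c * |kernel b r t| ≤ 1 + t := by
  have h1 := abs_kernel_le (r := r) hb ht
  have h2 := mul_abs_kernel_le hb hr ht
  have := mul_le_mul_of_nonneg_right hc (abs_nonneg (kernel b r t))
  linarith

theorem isMildSolution_solution (h0 : 0 < θ) (h1 : θ ≤ 1 / 2) (f : L2 n) :
    IsMildSolution θ 0 f (solution θ f) := by
  have mb : Measurable (logSymbol θ : Space n → ℝ) := measurable_logSymbol
  have b0 : ∀ ξ : Space n, 0 ≤ logSymbol θ ξ := logSymbol_nonneg
  have mK : ∀ t, Measurable fun ξ : Space n => kernel (logSymbol θ ξ) ‖ξ‖ t := fun t =>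
    measurable_kernel mb measurable_norm measurable_const
  have mK' : ∀ t, Measurable fun ξ : Space n => kernelDeriv (logSymbol θ ξ) ‖ξ‖ t := fun t =>
    measurable_kernelDeriv mb measurable_norm measurable_const
  have mJ : ∀ t, Measurable fun ξ : Space n => kernelInt (logSymbol θ ξ) ‖ξ‖ t := fun t =>
    measurable_kernelInt mb measurable_norm t
  have bK : ∀ (ξ : Space n) t, 0 ≤ t → |kernel (logSymbol θ ξ) ‖ξ‖ t| ≤ t := fun ξ t ht =>
    abs_kernel_le (b0 ξ) ht
  have bK' : ∀ (ξ : Space n) t, 0 ≤ t → |kernelDeriv (logSymbol θ ξ) ‖ξ‖ t| ≤ 1 := fun ξ t ht =>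
    abs_kernelDeriv_le (b0 ξ) ht
  have bJ : ∀ (ξ : Space n) t, 0 ≤ t → |kernelInt (logSymbol θ ξ) ‖ξ‖ t| ≤ t * t := fun ξ t ht =>
    abs_kernelInt_le (b0 ξ) ht
  have bL : ∀ (ξ : Space n) t, 0 ≤ t →
      |logSymbol θ ξ * kernel (logSymbol θ ξ) ‖ξ‖ t| ≤ 1 + t := fun ξ t ht => by
    rw [abs_mul, abs_of_nonneg (b0 ξ)]
    exact mul_abs_kernel_le_one_add (b0 ξ) (norm_nonneg ξ) ht (logSymbol_le_one_add h0 h1 ξ)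
  have bH : ∀ (ξ : Space n) t, 0 ≤ t →
      |√(1 + ‖ξ‖ ^ 2) * kernel (logSymbol θ ξ) ‖ξ‖ t| ≤ 1 + t := fun ξ t ht => by
    rw [abs_mul, abs_of_nonneg (Real.sqrt_nonneg _)]
    refine mul_abs_kernel_le_one_add (b0 ξ) (norm_nonneg ξ) ht ?_
    refine Real.sqrt_le_iff.2 ⟨by positivity, ?_⟩
    nlinarith [norm_nonneg ξ]
  have bA : ∀ (ξ : Space n) t, 0 ≤ t →
      |-‖ξ‖ ^ 2 * kernelInt (logSymbol θ ξ) ‖ξ‖ t| ≤ 1 + 1 + (1 + t) := fun ξ t ht => by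
    -- The bound t² on ∫K does not help against the unbounded r²; the integrated equation does.
    rw [neg_mul, abs_neg, sq_mul_kernelInt]
    refine (abs_sub _ _).trans (add_le_add ((abs_sub _ _).trans (add_le_add ?_ (bK' ξ t ht)))
      (bL ξ t ht))
    simp
  have mono1 : MonotoneOn (fun t : ℝ => 1 + t) (Ici 0) := fun x _ y _ h => by simpa using h
  refine ⟨⟨fun t => fourierMul (fun ξ => √(1 + ‖ξ‖ ^ 2) * kernel (logSymbol θ ξ) ‖ξ‖ t) f,
    continuousOn_fourierMul (M := fun t => 1 + t) (fun t => by have := mK t; fun_prop) mono1 bH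
      (fun ξ => continuous_const.mul (continuous_kernel _ _)) f,
    fun t ht => isMultiplier_fourierMul (mK t) (by have := mK t; fun_prop)
      (fun ξ => bK ξ t ht) (fun ξ => bH ξ t ht) (fun ξ => rfl) f⟩, ?_,
    fun t => fourierMul (fun ξ => kernelDeriv (logSymbol θ ξ) ‖ξ‖ t) f, ?_, ?_, ?_, ?_⟩
  · refine fourier_injective ?_
    have hz : ((0 : L2 n) : Space n → ℂ) =ᵐ[volume] 0 := Lp.coeFn_zero _ _ _
    have h𝓕 : (𝓕 (0 : L2 n) : L2 n) = 0 := (Lp.fourierTransformₗᵢ (Space n) ℂ).map_zero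
    rw [h𝓕]
    filter_upwards [coeFn_fourier_fourierMul (mK 0) (fun ξ => bK ξ 0 le_rfl) f, hz] with η e1 e2
    rw [solution, e1, e2]
    simp
  · exact continuousOn_fourierMul (M := fun _ => 1) mK' (fun _ _ _ _ _ => le_rfl) bK'
      (fun ξ => continuous_kernelDeriv _ _) f
  · intro t ht
    exact hasDerivWithinAt_fourierMul (M := fun _ => 1) mK mK' (fun _ _ _ _ _ => le_rfl) bK bK'
      (fun ξ t => hasDerivAt_kernel _ _ t) f ht
  · refine fourier_injective ?_
    filter_upwards [coeFn_fourier_fourierMul (mK' 0) (fun ξ => bK' ξ 0 le_rfl) f] with η e1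
    rw [e1]
    simp
  · intro t ht
    -- The multiplier with symbol ∫K vanishes at time 0 and has derivative u, so the fundamental
    -- theorem of calculus identifies the Bochner integral without commuting it with the Fourier
    -- transform.
    have hJ : ∫ s in (0 : ℝ)..t, solution θ f s
        = fourierMul (fun ξ => kernelInt (logSymbol θ ξ) ‖ξ‖ t) f := by
      have hd : ∀ s, 0 ≤ s → HasDerivWithinAt
          (fun t => fourierMul (fun ξ : Space n => kernelInt (logSymbol θ ξ) ‖ξ‖ t) f)
          (solution θ f s) (Ici 0) s := fun s hs =>
        hasDerivWithinAt_fourierMul (M := fun t => t) mJ mK (fun _ _ _ _ h => h) bJ bK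
          (fun ξ t => hasDerivAt_kernelInt _ _ t) f hs
      have hcu : ContinuousOn (solution θ f) (Ici 0) :=
        continuousOn_fourierMul (M := fun t => t) mK (fun _ _ _ _ h => h) bK
          (fun ξ => continuous_kernel _ _) f
      have hJ0 : fourierMul (fun ξ : Space n => kernelInt (logSymbol θ ξ) ‖ξ‖ 0) f = 0 := by
        refine fourier_injective ?_
        have hz : ((0 : L2 n) : Space n → ℂ) =ᵐ[volume] 0 := Lp.coeFn_zero _ _ _
        have h𝓕 : (𝓕 (0 : L2 n) : L2 n) = 0 := (Lp.fourierTransformₗᵢ (Space n) ℂ).map_zero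
        rw [h𝓕]
        filter_upwards [coeFn_fourier_fourierMul (mJ 0) (fun ξ => bJ ξ 0 le_rfl) f, hz]
          with η e1 e2
        rw [e1, e2]
        simp
      have := intervalIntegral.integral_eq_sub_of_hasDeriv_right_of_le ht
        (fun s hs => (hd s hs.1).continuousWithinAt.mono Icc_subset_Ici_self)
        (fun s hs => (hd s hs.1.le).mono (Ioi_subset_Ici hs.1.le))
        ((hcu.mono (by rw [uIcc_of_le ht]; exact Icc_subset_Ici_self)).intervalIntegrable)
      rw [this, hJ0, sub_zero]
    refine ⟨fourierMul (fun ξ => -‖ξ‖ ^ 2 * kernelInt (logSymbol θ ξ) ‖ξ‖ t) f,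
      fourierMul (fun ξ => logSymbol θ ξ * kernel (logSymbol θ ξ) ‖ξ‖ t) f, ?_, ?_, ?_⟩
    · rw [hJ]
      exact isMultiplier_fourierMul (mJ t) (by have := mJ t; fun_prop)
        (fun ξ => bJ ξ t ht) (fun ξ => bA ξ t ht) (fun ξ => rfl) f
    · rw [sub_zero]
      exact isMultiplier_fourierMul (mK t) (by have := mK t; fun_prop)
        (fun ξ => bK ξ t ht) (fun ξ => bL ξ t ht) (fun ξ => rfl) f
    · set a := fourierMul (fun ξ : Space n => -‖ξ‖ ^ 2 * kernelInt (logSymbol θ ξ) ‖ξ‖ t) f with ha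
      set d := fourierMul (fun ξ : Space n => logSymbol θ ξ * kernel (logSymbol θ ξ) ‖ξ‖ t) f
        with hd
      refine fourier_injective ?_
      have hadd : (𝓕 (f + a - d) : L2 n) = (𝓕 f : L2 n) + (𝓕 a : L2 n) - (𝓕 d : L2 n) := by
        change (Lp.fourierTransformₗᵢ (Space n) ℂ) _ = _
        rw [map_sub, map_add]
        rfl
      rw [hadd]
      filter_upwards [coeFn_fourier_fourierMul (mK' t) (fun ξ => bK' ξ t ht) f,
        coeFn_fourier_fourierMul (by have := mJ t; fun_prop) (fun ξ => bA ξ t ht) f,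
        coeFn_fourier_fourierMul (by have := mK t; fun_prop) (fun ξ => bL ξ t ht) f,
        Lp.coeFn_sub ((𝓕 f : L2 n) + (𝓕 a : L2 n)) (𝓕 d : L2 n),
        Lp.coeFn_add (𝓕 f : L2 n) (𝓕 a : L2 n)] with η e1 e2 e3 e4 e5
      rw [e1, e4, Pi.sub_apply, e5, Pi.add_apply, ha, hd, e2, e3]
      have := sq_mul_kernelInt (logSymbol θ ((2 * Real.pi) • η)) ‖(2 * Real.pi) • η‖ t
      have k : kernelDeriv (logSymbol θ ((2 * Real.pi) • η)) ‖(2 * Real.pi) • η‖ t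
          = 1 + -‖(2 * Real.pi) • η‖ ^ 2 *
              kernelInt (logSymbol θ ((2 * Real.pi) • η)) ‖(2 * Real.pi) • η‖ t
            - logSymbol θ ((2 * Real.pi) • η) *
              kernel (logSymbol θ ((2 * Real.pi) • η)) ‖(2 * Real.pi) • η‖ t := by linarith
      rw [k, Complex.ofReal_sub, Complex.ofReal_add, Complex.ofReal_one]
      ring

end Existence

/-! ### Uniqueness by frequency cutoff -/

section Uniqueness

variable {n : ℕ} {θ : ℝ}

/-- Frequency cutoff of a symbol, in Mathlib's frequency variable. -/
def cutoff (R : ℝ) (m : Space n → ℝ) (η : Space n) : ℝ :=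
  open Classical in if ‖(2 * Real.pi) • η‖ ≤ R then m ((2 * Real.pi) • η) else 0

theorem measurable_cutoff (R : ℝ) {m : Space n → ℝ} (hm : Measurable m) :
    AEStronglyMeasurable (cutoff R m) := by
  refine (Measurable.ite ?_ (hm.comp (measurable_const_smul _))
    measurable_const).aestronglyMeasurable
  exact measurableSet_le (by fun_prop) measurable_const

theorem abs_cutoff_le {R C : ℝ} {m : Space n → ℝ} (hC : 0 ≤ C) (h : ∀ ξ, ‖ξ‖ ≤ R → |m ξ| ≤ C)
    (η : Space n) : |cutoff R m η| ≤ C := by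
  unfold cutoff
  split_ifs with h'
  · exact h _ h'
  · simpa using hC

/-- The cutoff of a locally bounded Fourier multiplier, acting on the Fourier side. -/
def cutoffCLM (R : ℝ) (m : Space n → ℝ) (hm : Measurable m) (C : ℝ) (hC : 0 ≤ C)
    (h : ∀ ξ, ‖ξ‖ ≤ R → |m ξ| ≤ C) : L2 n →L[ℂ] L2 n :=
  mulCLM (cutoff R m) C (measurable_cutoff R hm) (Eventually.of_forall (abs_cutoff_le hC h))

theorem coeFn_cutoffCLM {R : ℝ} {m : Space n → ℝ} (hm : Measurable m) {C : ℝ} (hC : 0 ≤ C)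
    (h : ∀ ξ, ‖ξ‖ ≤ R → |m ξ| ≤ C) (f : L2 n) :
    cutoffCLM R m hm C hC h f =ᵐ[volume] fun η => (cutoff R m η : ℂ) * f η :=
  coeFn_mulLp (measurable_cutoff R hm) (Eventually.of_forall (abs_cutoff_le hC h)) f

/-- The Fourier transform followed by the frequency cutoff. -/
def cutFourier (R : ℝ) : L2 n →L[ℂ] L2 n :=
  (cutoffCLM R (fun _ => 1) measurable_const 1 zero_le_one (fun _ _ => by simp)).comp
    (Lp.fourierTransformₗᵢ (Space n) ℂ).toContinuousLinearEquiv.toContinuousLinearMap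

theorem coeFn_cutFourier (R : ℝ) (f : L2 n) : cutFourier R f =ᵐ[volume]
    fun η => (cutoff R (fun _ => 1) η : ℂ) * (𝓕 f : L2 n) η :=
  coeFn_cutoffCLM (C := 1) measurable_const zero_le_one (fun _ _ => by simp) _

/-- On a frequency ball Δ and L_θ become bounded operators, which makes the equation an ODE with a
Lipschitz right-hand side. -/
theorem cutFourier_of_isMultiplier {R : ℝ} {m : Space n → ℝ} (hm : Measurable m) {C : ℝ}
    (hC : 0 ≤ C) (h : ∀ ξ, ‖ξ‖ ≤ R → |m ξ| ≤ C) {f g : L2 n} (hfg : IsMultiplier m f g) :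
    cutFourier R g = cutoffCLM R m hm C hC h (cutFourier R f) := by
  refine Lp.ext ?_
  filter_upwards [coeFn_cutFourier R g, coeFn_cutFourier R f,
    coeFn_cutoffCLM hm hC h (cutFourier R f), isMultiplier_iff.1 hfg] with η e1 e2 e3 e4
  rw [e1, e3, e2, e4]
  unfold cutoff
  split_ifs <;> simp

theorem eq_of_forall_cutFourier_eq {f g : L2 n}
    (h : ∀ N : ℕ, cutFourier (N : ℝ) f = cutFourier (N : ℝ) g) : f = g := by
  refine fourier_injective ?_
  have h1 : ∀ᵐ η : Space n, ∀ N : ℕ, (cutoff (N : ℝ) (fun _ => 1) η : ℂ) * (𝓕 f : L2 n) η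
      = (cutoff (N : ℝ) (fun _ => 1) η : ℂ) * (𝓕 g : L2 n) η := by
    rw [ae_all_iff]
    intro N
    filter_upwards [coeFn_cutFourier (N : ℝ) f, coeFn_cutFourier (N : ℝ) g] with η e1 e2
    rw [← e1, ← e2, h N]
  filter_upwards [h1] with η hη
  obtain ⟨N, hN⟩ := exists_nat_ge ‖(2 * Real.pi) • η‖
  simpa [cutoff, hN] using hη N

/-- On each frequency ball, `(∫₀ᵗ u, u)` solves a linear differential equation with bounded
coefficients. -/
theorem eqOn_of_isMildSolution (h0 : 0 < θ) (h1 : θ ≤ 1 / 2) {f : L2 n} {u u' : ℝ → L2 n}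
    (hu : IsMildSolution θ 0 f u) (hu' : IsMildSolution θ 0 f u') : EqOn u' u (Ici 0) := by
  intro T hT
  have hT0 : (0 : ℝ) ≤ T := hT
  refine eq_of_forall_cutFourier_eq fun N => ?_
  set R : ℝ := (N : ℝ)
  have hR0 : 0 ≤ R := N.cast_nonneg
  have mA : Measurable fun ξ : Space n => -‖ξ‖ ^ 2 := by fun_prop
  have cA : ∀ ξ : Space n, ‖ξ‖ ≤ R → |-‖ξ‖ ^ 2| ≤ R ^ 2 := fun ξ hξ => by
    rw [abs_neg, abs_of_nonneg (by positivity)]; gcongr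
  have cB : ∀ ξ : Space n, ‖ξ‖ ≤ R → |logSymbol θ ξ| ≤ 1 + R := fun ξ hξ => by
    rw [abs_of_nonneg (logSymbol_nonneg ξ)]
    linarith [logSymbol_le_one_add h0 h1 ξ]
  set A := cutoffCLM R _ mA (R ^ 2) (by positivity) cA
  set B := cutoffCLM R (logSymbol θ) measurable_logSymbol (1 + R) (by positivity) cB
  set P : L2 n →L[ℂ] L2 n := cutFourier R
  -- The unknowns are P∫u and Pu; the second component is the mild equation for u_t after the
  -- cutoff.
  let G : L2 n × L2 n → L2 n × L2 n := fun x => (x.2, P f + A x.1 - B x.2)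
  obtain ⟨K, hK⟩ : ∃ K, LipschitzWith K G := by
    have hL : ∃ K, LipschitzWith K fun x : L2 n × L2 n => P f + A x.1 - B x.2 := by
      have e1 := A.lipschitz.comp (LipschitzWith.prod_fst (α := L2 n) (β := L2 n))
      have e2 := B.lipschitz.comp (LipschitzWith.prod_snd (α := L2 n) (β := L2 n))
      exact ⟨_, ((LipschitzWith.const (P f)).add e1).sub e2⟩
    obtain ⟨K, hK⟩ := hL
    exact ⟨_, LipschitzWith.prod_snd.prodMk hK⟩
  have main : ∀ u : ℝ → L2 n, IsMildSolution θ 0 f u → ∃ X : ℝ → L2 n × L2 n,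
      (∀ t ∈ Icc 0 T, (X t).2 = P (u t)) ∧ X 0 = 0 ∧ ContinuousOn X (Icc 0 T) ∧
        ∀ t ∈ Ico 0 T, HasDerivWithinAt X (G (X t)) (Ici t) t := by
    rintro u ⟨-, hu0, v, -, hud, -, hv⟩
    have huc : ContinuousOn u (Ici 0) := fun t ht => (hud t ht).continuousWithinAt
    -- Only the values for t ≥ 0 are controlled. Freezing u at u(0) for negative times gives a
    -- continuous curve on ℝ, whose primitive is differentiable at 0 as well.
    let w : ℝ → L2 n := fun t => u (max t 0)
    have hw : Continuous w := huc.comp_continuous (by fun_prop) fun t => le_max_right t 0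
    have hwu : ∀ t, 0 ≤ t → w t = u t := fun t ht => by simp only [w, max_eq_left ht]
    have hint : ∀ t, 0 ≤ t → ∫ s in (0 : ℝ)..t, u s = ∫ s in (0 : ℝ)..t, w s := fun t ht => by
      refine intervalIntegral.integral_congr fun s hs => ?_
      rw [uIcc_of_le ht] at hs
      exact (hwu s hs.1).symm
    have hd : ∀ t, 0 ≤ t → HasDerivWithinAt
        (fun t => (P (∫ s in (0 : ℝ)..t, w s), P (u t))) (P (w t), P (v t)) (Ici 0) t := by
      intro t ht
      refine HasDerivWithinAt.prodMk ?_ ?_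
      · exact ((P.restrictScalars ℝ).hasFDerivAt.comp_hasDerivAt t
          (hw.integral_hasStrictDerivAt 0 t).hasDerivAt).hasDerivWithinAt
      · exact (P.restrictScalars ℝ).hasFDerivAt.comp_hasDerivWithinAt t (hud t ht)
    refine ⟨fun t => (P (∫ s in (0 : ℝ)..t, w s), P (u t)), fun t _ => rfl, ?_, ?_, ?_⟩
    · simp [hu0]
    · exact fun t ht => (hd t ht.1).continuousWithinAt.mono Icc_subset_Ici_self
    · intro t ht
      obtain ⟨a, d, ha, hd', hvt⟩ := hv t ht.1
      convert! (hd t ht.1).mono (Ici_subset_Ici.2 ht.1) using 1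
      simp only [G]
      rw [hwu t ht.1, hvt, map_sub, map_add, ← hint t ht.1,
        cutFourier_of_isMultiplier mA (by positivity) cA ha,
        cutFourier_of_isMultiplier measurable_logSymbol (by positivity) cB hd', sub_zero]
  obtain ⟨X, hX1, hX2, hX3, hX4⟩ := main u hu
  obtain ⟨Y, hY1, hY2, hY3, hY4⟩ := main u' hu'
  have hXY := ODE_solution_unique_of_mem_Icc_right (v := fun _ => G) (s := fun _ => univ)
    (fun _ _ => hK.lipschitzOnWith) hY3 hY4 (fun _ _ => mem_univ _) hX3 hX4
    (fun _ _ => mem_univ _) (hY2.trans hX2.symm)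
  have hTT : T ∈ Icc 0 T := ⟨hT0, le_rfl⟩
  rw [← hX1 T hTT, ← hY1 T hTT, hXY hTT]

end Uniqueness

/-! ### Low- and high-frequency bounds for the logarithmic symbol -/

section SymbolBounds

variable {n : ℕ} {θ : ℝ} {ξ : Space n}

theorem rpow_half_le_logSymbol (h0 : 0 < θ) (hξ : ‖ξ‖ ≤ 1) :
    ‖ξ‖ ^ (2 * θ) / 2 ≤ logSymbol θ ξ := by
  have hx0 := Real.rpow_nonneg (norm_nonneg ξ) (2 * θ)
  have hx1 := Real.rpow_le_one (norm_nonneg ξ) hξ (show 0 ≤ 2 * θ by linarith)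
  refine le_trans ?_ (Real.le_log_one_add_of_nonneg hx0)
  rw [div_le_div_iff₀ (by norm_num) (by linarith)]
  nlinarith

theorem logSymbol_pos (hξ : 0 < ‖ξ‖) : 0 < logSymbol θ ξ :=
  Real.log_pos (by have := Real.rpow_pos_of_pos hξ (2 * θ); linarith)

/-- The radius 1/32768 = 32⁻³ works for all θ at once: 2 - 4θ ≥ 1/3 gives r^{2-4θ} ≤ 1/32, and 8/32
= (1/2)² matches b ≥ r^{2θ}/2. -/
theorem overdamped_of_norm_le (h0 : 0 < θ) (h1 : θ ≤ 5 / 12) (hξ0 : 0 < ‖ξ‖)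
    (hξ : ‖ξ‖ ≤ 1 / 32768) : 8 * ‖ξ‖ ^ 2 ≤ logSymbol θ ξ ^ 2 := by
  have hb := rpow_half_le_logSymbol h0 (hξ.trans (by norm_num))
  have hx0 := Real.rpow_pos_of_pos hξ0 (2 * θ)
  have e1 : ‖ξ‖ ^ 2 = (‖ξ‖ ^ (2 * θ)) ^ 2 * ‖ξ‖ ^ (2 - 4 * θ) := by
    rw [← Real.rpow_natCast (‖ξ‖ ^ (2 * θ)), ← Real.rpow_mul hξ0.le, ← Real.rpow_add hξ0,
      ← Real.rpow_natCast ‖ξ‖]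
    congr 1; push_cast; ring
  have e2 : ‖ξ‖ ^ (2 - 4 * θ) ≤ 1 / 32 := by
    calc ‖ξ‖ ^ (2 - 4 * θ) ≤ ‖ξ‖ ^ (1 / 3 : ℝ) :=
          Real.rpow_le_rpow_of_exponent_ge hξ0 (hξ.trans (by norm_num)) (by linarith)
      _ ≤ (1 / 32768 : ℝ) ^ (1 / 3 : ℝ) := Real.rpow_le_rpow hξ0.le hξ (by norm_num)
      _ = ((1 / 32 : ℝ) ^ (3 : ℝ)) ^ (1 / 3 : ℝ) := by norm_num
      _ = 1 / 32 := by rw [← Real.rpow_mul (by norm_num)]; norm_num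
  rw [e1]
  calc 8 * ((‖ξ‖ ^ (2 * θ)) ^ 2 * ‖ξ‖ ^ (2 - 4 * θ))
      ≤ 8 * ((‖ξ‖ ^ (2 * θ)) ^ 2 * (1 / 32)) := by gcongr
    _ = (‖ξ‖ ^ (2 * θ) / 2) ^ 2 := by ring
    _ ≤ _ := by gcongr

theorem rpow_le_sq_div_logSymbol (hξ : 0 < ‖ξ‖) :
    ‖ξ‖ ^ (2 - 2 * θ) ≤ ‖ξ‖ ^ 2 / logSymbol θ ξ := by
  rw [le_div_iff₀ (logSymbol_pos hξ)]
  calc ‖ξ‖ ^ (2 - 2 * θ) * logSymbol θ ξ ≤ ‖ξ‖ ^ (2 - 2 * θ) * ‖ξ‖ ^ (2 * θ) := by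
        gcongr; exact logSymbol_le_rpow ξ
    _ = ‖ξ‖ ^ 2 := by
      rw [← Real.rpow_add hξ, ← Real.rpow_natCast ‖ξ‖]; congr 1; push_cast; ring

theorem low_frequency_bounds (h0 : 0 < θ) (h1 : θ ≤ 5 / 12) (hξ0 : 0 < ‖ξ‖)
    (hξ : ‖ξ‖ ≤ 1 / 32768) {t : ℝ} (ht : 0 ≤ t) :
    ‖ξ‖ ^ (2 * θ) * |kernel (logSymbol θ ξ) ‖ξ‖ t|
        ≤ 4 * Real.exp (-(t * ‖ξ‖ ^ (2 - 2 * θ) / 2)) ∧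
      |kernel (logSymbol θ ξ) ‖ξ‖ t - profileKernel (logSymbol θ ξ) ‖ξ‖ t|
        ≤ 256 * ‖ξ‖ ^ (2 - 6 * θ) * Real.exp (-(t * ‖ξ‖ ^ (2 - 2 * θ) / 2)) := by
  have hb := rpow_half_le_logSymbol h0 (hξ.trans (by norm_num))
  have hb0 := logSymbol_pos (θ := θ) hξ0
  have hx0 := Real.rpow_pos_of_pos hξ0 (2 * θ)
  have hod := overdamped_of_norm_le h0 h1 hξ0 hξ
  have hq := mul_le_mul_of_nonneg_right (rpow_le_sq_div_logSymbol (θ := θ) hξ0) ht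
  have hp0 := mul_nonneg (Real.rpow_nonneg hξ0.le (2 - 2 * θ)) ht
  constructor
  · calc _ ≤ ‖ξ‖ ^ (2 * θ) *
          (2 / logSymbol θ ξ * Real.exp (-(‖ξ‖ ^ 2 / logSymbol θ ξ * t))) := by
          gcongr; exact abs_kernel_le_of_overdamped hb0 hod ht
      _ = 2 * (‖ξ‖ ^ (2 * θ) / logSymbol θ ξ) *
          Real.exp (-(‖ξ‖ ^ 2 / logSymbol θ ξ * t)) := by ring
      _ ≤ 2 * 2 * Real.exp (-(t * ‖ξ‖ ^ (2 - 2 * θ) / 2)) := by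
        gcongr
        · rw [div_le_iff₀ hb0]; linarith
        · linarith
      _ = _ := by ring
  · refine (abs_kernel_sub_profileKernel_le hb0 hod ht).trans ?_
    have e1 : ‖ξ‖ ^ 2 / logSymbol θ ξ ^ 3 ≤ 8 * ‖ξ‖ ^ (2 - 6 * θ) := by
      rw [div_le_iff₀ (by positivity)]
      calc ‖ξ‖ ^ 2 = 8 * ‖ξ‖ ^ (2 - 6 * θ) * (‖ξ‖ ^ (2 * θ) / 2) ^ 3 := by
            rw [div_pow, ← Real.rpow_natCast (‖ξ‖ ^ (2 * θ)), ← Real.rpow_mul hξ0.le]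
            rw [show (8 : ℝ) * ‖ξ‖ ^ (2 - 6 * θ) * (‖ξ‖ ^ (2 * θ * ((3 : ℕ) : ℝ)) / 2 ^ 3)
              = ‖ξ‖ ^ (2 - 6 * θ) * ‖ξ‖ ^ (2 * θ * ((3 : ℕ) : ℝ)) by ring, ← Real.rpow_add hξ0,
              ← Real.rpow_natCast ‖ξ‖]
            congr 1; push_cast; ring
        _ ≤ _ := by gcongr
    calc _ ≤ 32 * (8 * ‖ξ‖ ^ (2 - 6 * θ)) * Real.exp (-(t * ‖ξ‖ ^ (2 - 2 * θ) / 2)) := by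
          gcongr 32 * ?_ * Real.exp ?_
          linarith
      _ = _ := by ring

theorem mul_sq_logSymbol_le (h0 : 0 < θ) (h1 : θ ≤ 1 / 2) {δ : ℝ} (hδ : 0 < δ) (hδ1 : δ ≤ 1)
    (hξ : δ ≤ ‖ξ‖) : δ ^ 2 * logSymbol θ ξ ^ 2 ≤ ‖ξ‖ ^ 2 := by
  rw [← mul_pow]
  have hb := logSymbol_nonneg (θ := θ) ξ
  gcongr
  rcases le_total ‖ξ‖ 1 with h | h
  · have := (logSymbol_le_rpow ξ).trans
      (Real.rpow_le_one (norm_nonneg ξ) h (show 0 ≤ 2 * θ by linarith))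
    nlinarith
  · have h2 := Real.rpow_le_rpow_of_exponent_le h (show 2 * θ ≤ 1 by linarith)
    rw [Real.rpow_one] at h2
    have := (logSymbol_le_rpow ξ).trans h2
    nlinarith

theorem log_one_add_rpow_le_logSymbol (h0 : 0 < θ) {δ : ℝ} (hδ : 0 < δ) (hξ : δ ≤ ‖ξ‖) :
    Real.log (1 + δ ^ (2 * θ)) ≤ logSymbol θ ξ := by
  have := Real.rpow_pos_of_pos hδ (2 * θ)
  have := Real.rpow_le_rpow hδ.le hξ (show 0 ≤ 2 * θ by linarith)
  exact Real.log_le_log (by linarith) (by linarith)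

/-- Subadditivity of x ↦ x^{2θ} gives b ≥ 2θ log(1 + r). Logarithmic damping thus yields polynomial
decay in the frequency, of a degree that grows with time; integrability needs a waiting time. -/
theorem exp_neg_mul_logSymbol_le (h0 : 0 < θ) (h1 : θ ≤ 1 / 2) {s : ℝ} (hs : 0 ≤ s)
    (ξ : Space n) : Real.exp (-(s * logSymbol θ ξ)) ≤ (1 + ‖ξ‖) ^ (-(2 * θ * s)) := by
  have hr := norm_nonneg ξ
  have hsub := Real.rpow_add_le_add_rpow zero_le_one hr (show 0 ≤ 2 * θ by linarith)
    (show 2 * θ ≤ 1 by linarith)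
  rw [Real.one_rpow] at hsub
  have hpos : 0 < 1 + ‖ξ‖ := by linarith
  have hlog : 2 * θ * Real.log (1 + ‖ξ‖) ≤ logSymbol θ ξ := by
    rw [← Real.log_rpow hpos]
    exact Real.log_le_log (Real.rpow_pos_of_pos hpos _) hsub
  rw [Real.rpow_def_of_pos hpos]
  apply Real.exp_le_exp.2
  nlinarith

end SymbolBounds

/-! ### The Fourier transform of the data near the zero frequency -/

section FourierData

variable {n : ℕ} {f : Space n → ℂ}

theorem norm_fourier_le_normL1 (η : Space n) : ‖(𝓕 f : Space n → ℂ) η‖ ≤ normL1 f :=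
  VectorFourier.norm_fourierIntegral_le_integral_norm _ _ _ _ _

theorem norm_exp_sub_one_le_rpow {s : ℝ} (hs0 : 0 < s) (hs1 : s ≤ 1) (y : ℝ) {z : ℝ}
    (hz : |y| ≤ z) : ‖Complex.exp (Complex.I * y) - 1‖ ≤ 2 * z ^ s := by
  have hz0 : 0 ≤ z := (abs_nonneg y).trans hz
  rcases le_total z 1 with h | h
  · have h1 : ‖Complex.exp (Complex.I * y) - 1‖ ≤ |y| := by
      simpa using Real.norm_exp_I_mul_ofReal_sub_one_le (x := y)
    have h2 : z ≤ z ^ s := by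
      rcases hz0.eq_or_lt with h' | h'
      · rw [← h', Real.zero_rpow hs0.ne']
      · simpa using Real.rpow_le_rpow_of_exponent_ge h' h hs1
    linarith [Real.rpow_nonneg hz0 s]
  · have h1 : ‖Complex.exp (Complex.I * y) - 1‖ ≤ 2 := by
      refine (norm_sub_le _ _).trans ?_
      rw [mul_comm, Complex.norm_exp_ofReal_mul_I]
      norm_num
    linarith [Real.one_le_rpow h hs0.le]

/-- Interpolating |e^{iy} - 1| between |y| and 2 converts a moment of order s ≤ 1 into Hölder decay
at the origin; s = 2θ is the power that offsets 1/b. -/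
theorem norm_fourier_sub_integral_le {s : ℝ} (hs0 : 0 < s) (hs1 : s ≤ 1)
    (hf : MemL1Weighted s f) (η : Space n) :
    ‖(𝓕 f : Space n → ℂ) η - ∫ x, f x‖ ≤ 2 * ‖(2 * Real.pi) • η‖ ^ s * normL1Weighted s f := by
  obtain ⟨h1, h2⟩ := hf
  have hpt : ∀ x, ‖Complex.exp (Complex.I * ((-2 * Real.pi * inner ℝ x η : ℝ) : ℂ)) - 1‖
      ≤ 2 * (‖(2 * Real.pi) • η‖ ^ s * ‖x‖ ^ s) := fun x => by
    rw [← Real.mul_rpow (norm_nonneg _) (norm_nonneg _)]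
    refine norm_exp_sub_one_le_rpow hs0 hs1 _ ?_
    rw [norm_smul, abs_mul, Real.norm_eq_abs, neg_mul, abs_neg]
    have := abs_real_inner_le_norm x η
    calc |2 * Real.pi| * |inner ℝ x η| ≤ |2 * Real.pi| * (‖x‖ * ‖η‖) := by gcongr
      _ = _ := by ring
  have hint : Integrable fun x =>
      Complex.exp (((-2 * Real.pi * inner ℝ x η : ℝ) : ℂ) * Complex.I) • f x := by
    refine h1.mono ?_ (Eventually.of_forall fun x => ?_)
    · have hc : Continuous fun x : Space n =>
          Complex.exp (((-2 * Real.pi * inner ℝ x η : ℝ) : ℂ) * Complex.I) := by fun_prop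
      exact hc.aestronglyMeasurable.smul h1.aestronglyMeasurable
    · rw [norm_smul, Complex.norm_exp_ofReal_mul_I, one_mul]
  rw [Real.fourier_eq', ← integral_sub hint h1, normL1Weighted, ← integral_const_mul]
  refine norm_integral_le_of_norm_le (h2.const_mul _) (Eventually.of_forall fun x => ?_)
  rw [smul_eq_mul, ← sub_one_mul, norm_mul, mul_comm (Complex.ofReal _) Complex.I]
  have hx := Real.rpow_nonneg (norm_nonneg x) s
  have hη := Real.rpow_nonneg (norm_nonneg ((2 * Real.pi) • η)) s
  calc _ ≤ 2 * (‖(2 * Real.pi) • η‖ ^ s * ‖x‖ ^ s) * ‖f x‖ := by gcongr; exact hpt x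
    _ ≤ 2 * (‖(2 * Real.pi) • η‖ ^ s * (1 + ‖x‖ ^ s)) * ‖f x‖ := by gcongr; linarith
    _ = _ := by ring

theorem normL1_nonneg : 0 ≤ normL1 f := integral_nonneg fun _ => norm_nonneg _

theorem normL1Weighted_nonneg {γ : ℝ} : 0 ≤ normL1Weighted γ f :=
  integral_nonneg fun x => mul_nonneg
    (by have := Real.rpow_nonneg (norm_nonneg x) γ; linarith) (norm_nonneg _)

end FourierData

/-! ### Radial integrals with constants independent of the exponent -/

section RadialIntegrals

variable {n : ℕ} {a p : ℝ}

theorem integrable_rpow_mul_exp (hn : 1 ≤ n) (han : a < n) (hp : 0 < p) {c : ℝ} (hc : 0 < c) :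
    Integrable fun ξ : Space n => ‖ξ‖ ^ (-a) * Real.exp (-c * ‖ξ‖ ^ p) := by
  have : Nonempty (Fin n) := ⟨⟨0, hn⟩⟩
  have : Nontrivial (Space n) := inferInstance
  rw [integrable_fun_norm_addHaar (volume : Measure (Space n))
    (f := fun y => y ^ (-a) * Real.exp (-c * y ^ p))]
  have h := integrableOn_rpow_mul_exp_neg_mul_rpow (s := (n : ℝ) - 1 - a) (p := p) (b := c)
    (by linarith) hp hc
  refine h.congr_fun (fun y hy => ?_) measurableSet_Ioi
  have hy0 : (0 : ℝ) < y := hy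
  rw [finrank_euclideanSpace_fin, smul_eq_mul, ← mul_assoc, ← Real.rpow_natCast,
    ← Real.rpow_add hy0, Nat.cast_sub hn]
  simp only [Nat.cast_one, sub_eq_add_neg]

/-- The decay rate of the dominating Gaussian-type function, uniformly in the exponent `p`. -/
theorem integral_rpow_mul_exp_le (hn : 1 ≤ n) (han : a < n) (hp : 1 ≤ p) {t : ℝ} (ht : 0 < t) :
    ∫ ξ : Space n, ‖ξ‖ ^ (-a) * Real.exp (-t * ‖ξ‖ ^ p)
      ≤ (∫ ξ : Space n, Real.exp 1 * (‖ξ‖ ^ (-a) * Real.exp (-1 * ‖ξ‖ ^ (1 : ℝ)))) *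
        t ^ (-((n - a) / p)) := by
  have hp0 : 0 < p := by linarith
  -- The rescaling ξ = sζ turns t|ξ|^p into |ζ|^p.
  set s : ℝ := t ^ (-(1 / p)) with hs
  have hs0 : 0 < s := Real.rpow_pos_of_pos ht _
  have hcomp := Measure.integral_comp_inv_smul_of_nonneg (volume : Measure (Space n))
    (fun ζ : Space n => s ^ (-a) * (‖ζ‖ ^ (-a) * Real.exp (-1 * ‖ζ‖ ^ p))) hs0.le
  have hsp : s ^ p = t⁻¹ := by
    rw [hs, ← Real.rpow_mul ht.le, neg_mul, one_div_mul_cancel hp0.ne', Real.rpow_neg_one]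
  have e1 : ∀ ξ : Space n, s ^ (-a) * (‖s⁻¹ • ξ‖ ^ (-a) * Real.exp (-1 * ‖s⁻¹ • ξ‖ ^ p))
      = ‖ξ‖ ^ (-a) * Real.exp (-t * ‖ξ‖ ^ p) := fun ξ => by
    rw [norm_smul, Real.norm_eq_abs, abs_of_pos (inv_pos.2 hs0),
      Real.mul_rpow (inv_pos.2 hs0).le (norm_nonneg _),
      Real.mul_rpow (inv_pos.2 hs0).le (norm_nonneg _), Real.inv_rpow hs0.le, Real.inv_rpow hs0.le,
      hsp, inv_inv, ← mul_assoc, ← mul_assoc, mul_inv_cancel₀ (Real.rpow_pos_of_pos hs0 _).ne',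
      one_mul]
    ring_nf
  simp_rw [e1] at hcomp
  rw [hcomp, finrank_euclideanSpace_fin, integral_const_mul, smul_eq_mul, ← mul_assoc,
    ← Real.rpow_natCast, ← Real.rpow_add hs0, hs, ← Real.rpow_mul ht.le, mul_comm]
  have e2 : -(1 / p) * ((n : ℝ) + -a) = -((n - a) / p) := by ring
  rw [e2]
  refine mul_le_mul_of_nonneg_right ?_ (Real.rpow_nonneg ht.le _)
  refine integral_mono (integrable_rpow_mul_exp hn han hp0 one_pos)
    ((integrable_rpow_mul_exp hn han one_pos one_pos).const_mul _) fun ζ => ?_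
  have hz := Real.rpow_nonneg (norm_nonneg ζ) (-a)
  -- Hence exp(-|ζ|^p) ≤ e · exp(-|ζ|), which frees the constant from p = 2 - 2θ and so from θ.
  have h1 : ‖ζ‖ ≤ ‖ζ‖ ^ p + 1 := by
    rcases le_total ‖ζ‖ 1 with h | h
    · linarith [Real.rpow_nonneg (norm_nonneg ζ) p]
    · have := Real.rpow_le_rpow_of_exponent_le h hp
      rw [Real.rpow_one] at this
      linarith
  simp only [Real.rpow_one]
  rw [mul_left_comm, ← Real.exp_add]
  gcongr
  linarith

end RadialIntegrals

/-! ### The high-frequency contribution -/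

/-- The upper bound for the squared kernels away from the zero frequency. -/
def highBound (n : ℕ) (θ δ t : ℝ) : ℝ :=
  (t + 1 / Real.log (1 + δ ^ (2 * θ))) ^ 2 *
    Real.exp (-(2 * δ ^ 2 * Real.log (1 + δ ^ (2 * θ)) * (t - (n + 1) / (4 * θ * δ ^ 2))))

section HighFrequency

variable {n : ℕ} {θ δ t : ℝ} {ξ : Space n}

/-- The time is split as T₀ + (t - T₀). The share T₀ is fixed by 2θ · 2δ²T₀ = n + 1 and buys the
integrable weight; in the rest b is replaced by its minimum over |ξ| ≥ δ, which gives exponential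
decay in t. -/
theorem sq_mul_exp_le_highBound (h0 : 0 < θ) (h1 : θ ≤ 1 / 2) (hδ : 0 < δ) (hξ : δ ≤ ‖ξ‖)
    (ht : (n + 1) / (4 * θ * δ ^ 2) ≤ t) :
    ((t + 1 / logSymbol θ ξ) * Real.exp (-(δ ^ 2 * logSymbol θ ξ * t))) ^ 2
      ≤ highBound n θ δ t * (1 + ‖ξ‖) ^ (-((n : ℝ) + 1)) := by
  set T₀ : ℝ := (n + 1) / (4 * θ * δ ^ 2) with hT
  have hT0 : 0 ≤ T₀ := by positivity
  have hl0 : 0 < Real.log (1 + δ ^ (2 * θ)) :=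
    Real.log_pos (by have := Real.rpow_pos_of_pos hδ (2 * θ); linarith)
  have hl := log_one_add_rpow_le_logSymbol h0 hδ hξ
  set l := Real.log (1 + δ ^ (2 * θ))
  set b := logSymbol θ ξ with hb
  have hb0 : 0 < b := hl0.trans_le hl
  have hexp : Real.exp (-(δ ^ 2 * b * t)) ^ 2
      = Real.exp (-(2 * δ ^ 2 * b * (t - T₀))) * Real.exp (-(2 * δ ^ 2 * T₀ * b)) := by
    rw [← Real.exp_nat_mul, ← Real.exp_add]; congr 1; push_cast; ring
  have e1 := exp_neg_mul_logSymbol_le h0 h1 (show 0 ≤ 2 * δ ^ 2 * T₀ by positivity) ξ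
  have e2 : 2 * θ * (2 * δ ^ 2 * T₀) = n + 1 := by rw [hT]; field_simp; ring
  rw [e2] at e1
  have hs : 0 ≤ t - T₀ := sub_nonneg.2 ht
  have ht0 : 0 ≤ t := hT0.trans ht
  rw [mul_pow, hexp, ← mul_assoc, highBound]
  gcongr

theorem abs_kernel_le_highBound (h0 : 0 < θ) (h1 : θ ≤ 1 / 2) (hδ : 0 < δ) (hδ1 : δ ≤ 1 / 2)
    (hξ : δ ≤ ‖ξ‖) (ht : 0 ≤ t) :
    |kernel (logSymbol θ ξ) ‖ξ‖ t| + |profileKernel (logSymbol θ ξ) ‖ξ‖ t|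
      ≤ (t + 1 / logSymbol θ ξ) * Real.exp (-(δ ^ 2 * logSymbol θ ξ * t)) := by
  have hb := logSymbol_pos (θ := θ) (hδ.trans_le hξ)
  have hc := mul_sq_logSymbol_le h0 h1 hδ (hδ1.trans (by norm_num)) hξ
  have hδ2 : δ ^ 2 ≤ 1 / 2 := by nlinarith
  rw [add_mul]
  exact add_le_add (abs_kernel_le_of_mul_sq_le hb hδ2 hc ht)
    (abs_profileKernel_le_of_mul_sq_le hb hδ2 hc ht)

theorem integrable_highBound (C : ℝ) :
    Integrable fun ξ : Space n => C * (1 + ‖ξ‖) ^ (-((n : ℝ) + 1)) :=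
  (integrable_one_add_norm (by rw [finrank_euclideanSpace_fin]; linarith)).const_mul C

theorem profile_eq (u₁ : Space n → ℂ) (ξ : Space n) :
    profile θ u₁ t ξ = (profileKernel (logSymbol θ ξ) ‖ξ‖ t : ℂ) * ∫ x, u₁ x := rfl

theorem measurable_profileKernel :
    Measurable fun ξ : Space n => profileKernel (logSymbol θ ξ) ‖ξ‖ t := by
  have := measurable_logSymbol (n := n) (θ := θ)
  unfold profileKernel
  fun_prop

theorem ae_norm_pos (hn : 1 ≤ n) : ∀ᵐ ξ : Space n, 0 < ‖ξ‖ := by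
  have : Nonempty (Fin n) := ⟨⟨0, hn⟩⟩
  filter_upwards [Measure.ae_ne (volume : Measure (Space n)) 0] with ξ hξ using norm_pos_iff.2 hξ

theorem memLp_profile (hn : 1 ≤ n) (h0 : 0 < θ) (h1 : θ ≤ 5 / 12)
    (ht : (n + 1) / (4 * θ * (1 / 32768) ^ 2) ≤ t) (u₁ : Space n → ℂ) :
    MemLp (profile θ u₁ t) 2 volume := by
  have ht0 : 0 ≤ t := le_trans (by positivity) ht
  have hK : MemLp (fun ξ : Space n => profileKernel (logSymbol θ ξ) ‖ξ‖ t) 2 volume := by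
    have hm := (measurable_profileKernel (n := n) (θ := θ) (t := t)).aestronglyMeasurable
      (μ := volume)
    rw [memLp_two_iff_integrable_sq hm]
    have hB : 0 ≤ highBound n θ (1 / 32768) t := by unfold highBound; positivity
    -- The factor 2^{n+1} compensates for the weight on |ξ| ≤ 1, so one majorant covers both
    -- frequency zones.
    refine (integrable_highBound (t ^ 2 * 2 ^ ((n : ℝ) + 1)
      + highBound n θ (1 / 32768) t)).mono' (hm.pow 2) ?_
    filter_upwards [ae_norm_pos hn] with ξ hξ
    have hx := Real.rpow_nonneg (show 0 ≤ 1 + ‖ξ‖ by positivity) (-((n : ℝ) + 1))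
    rw [Real.norm_eq_abs, abs_of_nonneg (sq_nonneg _), add_mul, ← sq_abs]
    rcases le_total ‖ξ‖ (1 / 32768) with h | h
    · have e1 := abs_profileKernel_le_of_overdamped (logSymbol_pos (θ := θ) hξ)
        (overdamped_of_norm_le h0 h1 hξ h) ht0
      have e2 : 1 ≤ (2 : ℝ) ^ ((n : ℝ) + 1) * (1 + ‖ξ‖) ^ (-((n : ℝ) + 1)) := by
        rw [Real.rpow_neg (by positivity), ← div_eq_mul_inv, one_le_div (by positivity)]
        exact Real.rpow_le_rpow (by positivity) (by linarith) (by positivity)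
      have e3 : t ^ 2 ≤ t ^ 2 * 2 ^ ((n : ℝ) + 1) * (1 + ‖ξ‖) ^ (-((n : ℝ) + 1)) := by
        rw [mul_assoc]; exact le_mul_of_one_le_right (sq_nonneg t) e2
      have e4 : |profileKernel (logSymbol θ ξ) ‖ξ‖ t| ^ 2 ≤ t ^ 2 := by gcongr
      have := mul_nonneg hB hx
      linarith
    · have e1 := abs_kernel_le_highBound h0 (h1.trans (by norm_num)) (by norm_num) (by norm_num) h
        ht0
      have e2 := sq_mul_exp_le_highBound h0 (h1.trans (by norm_num)) (by norm_num) h ht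
      have e3 : |profileKernel (logSymbol θ ξ) ‖ξ‖ t| ^ 2 ≤
          ((t + 1 / logSymbol θ ξ) * Real.exp (-((1 / 32768) ^ 2 * logSymbol θ ξ * t))) ^ 2 := by
        gcongr
        linarith [abs_nonneg (kernel (logSymbol θ ξ) ‖ξ‖ t)]
      have : 0 ≤ t ^ 2 * 2 ^ ((n : ℝ) + 1) * (1 + ‖ξ‖) ^ (-((n : ℝ) + 1)) := by positivity
      linarith
  have := hK.ofReal (K := ℂ)
  exact this.mul_const (∫ x, u₁ x)

/-- The high-frequency contribution decays faster than any power. -/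
theorem eventually_highBound_mul_le (hδ : 0 < δ) (M q : ℝ) :
    ∀ᶠ t in atTop, highBound n θ δ t * M ≤ t ^ (-q) := by
  have hl0 : 0 < Real.log (1 + δ ^ (2 * θ)) :=
    Real.log_pos (by have := Real.rpow_pos_of_pos hδ (2 * θ); linarith)
  unfold highBound
  set l := Real.log (1 + δ ^ (2 * θ))
  set T₀ : ℝ := (n + 1) / (4 * θ * δ ^ 2)
  set k := 2 * δ ^ 2 * l with hk
  have hk0 : 0 < k := by positivity
  -- The 4 comes from t + 1/l ≤ 2t for t ≥ 1/l, and exp(kT₀) undoes the time shift.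
  set D : ℝ := 4 * Real.exp (k * T₀) * |M| with hD
  have hlim := (tendsto_rpow_mul_exp_neg_mul_atTop_nhds_zero (2 + q) k hk0).const_mul D
  rw [mul_zero] at hlim
  filter_upwards [hlim.eventually_le_const one_pos, eventually_ge_atTop (1 / l),
    eventually_gt_atTop 0] with t h1 h2 h3
  have hq : 0 < t ^ q := Real.rpow_pos_of_pos h3 q
  have e1 : (t + 1 / l) ^ 2 ≤ 4 * t ^ 2 := by
    have : 0 < 1 / l := by positivity
    nlinarith
  rw [Real.rpow_neg h3.le, ← one_div, le_div_iff₀ hq]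
  refine le_trans ?_ h1
  have e2 : Real.exp (-(k * (t - T₀))) = Real.exp (k * T₀) * Real.exp (-k * t) := by
    rw [← Real.exp_add]; congr 1; ring
  rw [e2, Real.rpow_add h3, Real.rpow_two]
  calc (t + 1 / l) ^ 2 * (Real.exp (k * T₀) * Real.exp (-k * t)) * M * t ^ q
      ≤ 4 * t ^ 2 * (Real.exp (k * T₀) * Real.exp (-k * t)) * |M| * t ^ q := by
        have hE : 0 ≤ Real.exp (k * T₀) * Real.exp (-k * t) := by positivity
        refine mul_le_mul_of_nonneg_right ?_ hq.le
        exact (mul_le_mul_of_nonneg_left (le_abs_self M) (by positivity)).trans (by gcongr)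
    _ = _ := by rw [hD]; ring

end HighFrequency

/-! ### The decay estimate -/

/-- The constant in the low-frequency integral. -/
def lowConst (n : ℕ) (a : ℝ) : ℝ :=
  ∫ ξ : Space n, Real.exp 1 * (‖ξ‖ ^ (-a) * Real.exp (-1 * ‖ξ‖ ^ (1 : ℝ)))

theorem lowConst_nonneg (n : ℕ) (a : ℝ) : 0 ≤ lowConst n a :=
  integral_nonneg fun ξ => by have := Real.rpow_nonneg (norm_nonneg ξ) (-a); positivity

section Decay

variable {n : ℕ} {θ a t : ℝ} {u₁ : Space n → ℂ}

/-- The function that dominates the square of the Fourier transform of the difference. -/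
def dominant (n : ℕ) (θ a t : ℝ) (ξ : Space n) : ℝ :=
  264 ^ 2 * (‖ξ‖ ^ (-a) * Real.exp (-t * ‖ξ‖ ^ (2 - 2 * θ)))
    + highBound n θ (1 / 32768) t * (1 + ‖ξ‖) ^ (-((n : ℝ) + 1))

/-- Here z stands for û₁(ξ), P for P₁, and A, B for bounds by the data norms. At low frequency Kz -
K₀P = K(z - P) + (K - K₀)P; the pieces carry the constants 2·4 = 8 and 256, and 264 is their sum.
Only the second piece can be singular at 0, which is why a enters. -/
theorem sq_norm_difference_le (h0 : 0 < θ) (h1 : θ ≤ 5 / 12) (ha : 0 ≤ a)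
    (haθ : -(a / 2) ≤ 2 - 6 * θ) (ht : (n + 1) / (4 * θ * (1 / 32768) ^ 2) ≤ t)
    {ξ : Space n} (hξ : 0 < ‖ξ‖) {z P : ℂ} {A B : ℝ} (hz : ‖z‖ ≤ A) (hP : ‖P‖ ≤ A)
    (hB : 0 ≤ B) (hzP : ‖z - P‖ ≤ 2 * ‖ξ‖ ^ (2 * θ) * B) :
    ‖(kernel (logSymbol θ ξ) ‖ξ‖ t : ℂ) * z - (profileKernel (logSymbol θ ξ) ‖ξ‖ t : ℂ) * P‖ ^ 2
      ≤ (A + B) ^ 2 * dominant n θ a t ξ := by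
  have ht0 : 0 ≤ t := le_trans (by positivity) ht
  have hA : 0 ≤ A := (norm_nonneg z).trans hz
  have hx := Real.rpow_nonneg (show 0 ≤ 1 + ‖ξ‖ by positivity) (-((n : ℝ) + 1))
  have hB0 : 0 ≤ highBound n θ (1 / 32768) t := by unfold highBound; positivity
  set K := kernel (logSymbol θ ξ) ‖ξ‖ t
  set K₀ := profileKernel (logSymbol θ ξ) ‖ξ‖ t
  rcases le_total ‖ξ‖ (1 / 32768) with h | h
  · obtain ⟨e1, e2⟩ := low_frequency_bounds h0 h1 hξ h ht0
    have hr1 : ‖ξ‖ ≤ 1 := h.trans (by norm_num)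
    set E := Real.exp (-(t * ‖ξ‖ ^ (2 - 2 * θ) / 2)) with hE
    have p1 : 1 ≤ ‖ξ‖ ^ (-(a / 2)) :=
      Real.one_le_rpow_of_pos_of_le_one_of_nonpos hξ hr1 (by linarith)
    have p2 : ‖ξ‖ ^ (2 - 6 * θ) ≤ ‖ξ‖ ^ (-(a / 2)) :=
      Real.rpow_le_rpow_of_exponent_ge hξ hr1 haθ
    have e3 : ‖(K : ℂ) * z - (K₀ : ℂ) * P‖ ≤ (A + B) * (264 * ‖ξ‖ ^ (-(a / 2)) * E) := by
      have hE0 : 0 ≤ E := (Real.exp_pos _).le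
      calc ‖(K : ℂ) * z - (K₀ : ℂ) * P‖ = ‖(K : ℂ) * (z - P) + ((K - K₀ : ℝ) : ℂ) * P‖ := by
            congr 1; push_cast; ring
        _ ≤ |K| * ‖z - P‖ + |K - K₀| * ‖P‖ := by
          refine (norm_add_le _ _).trans ?_
          rw [norm_mul, norm_mul, Complex.norm_real, Complex.norm_real, Real.norm_eq_abs,
            Real.norm_eq_abs]
        _ ≤ |K| * (2 * ‖ξ‖ ^ (2 * θ) * B) + 256 * ‖ξ‖ ^ (2 - 6 * θ) * E * A := by gcongr
        _ = 2 * (‖ξ‖ ^ (2 * θ) * |K|) * B + 256 * ‖ξ‖ ^ (2 - 6 * θ) * E * A := by ring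
        _ ≤ 2 * (4 * E) * B + 256 * ‖ξ‖ ^ (-(a / 2)) * E * A := by gcongr
        _ ≤ 264 * ‖ξ‖ ^ (-(a / 2)) * E * B + 264 * ‖ξ‖ ^ (-(a / 2)) * E * A := by
          refine add_le_add (mul_le_mul_of_nonneg_right ?_ hB) (by gcongr; norm_num)
          nlinarith [mul_le_mul_of_nonneg_right p1 hE0]
        _ = _ := by ring
    have e4 : (264 * ‖ξ‖ ^ (-(a / 2)) * E) ^ 2
        = 264 ^ 2 * (‖ξ‖ ^ (-a) * Real.exp (-t * ‖ξ‖ ^ (2 - 2 * θ))) := by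
      rw [mul_pow, mul_pow, mul_assoc]
      congr 2
      · rw [← Real.rpow_natCast, ← Real.rpow_mul hξ.le]; congr 1; push_cast; ring
      · rw [hE, ← Real.exp_nat_mul]; congr 1; push_cast; ring
    calc _ ≤ ((A + B) * (264 * ‖ξ‖ ^ (-(a / 2)) * E)) ^ 2 := by gcongr
      _ = (A + B) ^ 2 * (264 * ‖ξ‖ ^ (-(a / 2)) * E) ^ 2 := by ring
      _ ≤ _ := by
        rw [e4, dominant]
        gcongr
        exact le_add_of_nonneg_right (mul_nonneg hB0 hx)
  · have e1 := abs_kernel_le_highBound h0 (h1.trans (by norm_num)) (by norm_num) (by norm_num) h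
      ht0
    have e2 := sq_mul_exp_le_highBound h0 (h1.trans (by norm_num)) (by norm_num) h ht
    have e3 : ‖(K : ℂ) * z - (K₀ : ℂ) * P‖ ≤ (A + B) * (|K| + |K₀|) := by
      refine (norm_sub_le _ _).trans ?_
      rw [norm_mul, norm_mul, Complex.norm_real, Complex.norm_real, Real.norm_eq_abs,
        Real.norm_eq_abs]
      have h2 := mul_le_mul_of_nonneg_left hz (abs_nonneg K)
      have h3 := mul_le_mul_of_nonneg_left hP (abs_nonneg K₀)
      have h4 := mul_nonneg hB (abs_nonneg K)
      have h5 := mul_nonneg hB (abs_nonneg K₀)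
      nlinarith
    calc _ ≤ ((A + B) * (|K| + |K₀|)) ^ 2 := by gcongr
      _ = (A + B) ^ 2 * (|K| + |K₀|) ^ 2 := by ring
      _ ≤ _ := by
        gcongr
        refine le_trans ?_ ((pow_le_pow_left₀ (by positivity) e1 2).trans (e2.trans ?_))
        · exact le_rfl
        · rw [dominant]
          have := Real.rpow_nonneg hξ.le (-a)
          exact le_add_of_nonneg_left (by positivity)

theorem integrable_dominant (hn : 1 ≤ n) (h1 : θ ≤ 5 / 12) (han : a < n) (ht : 0 < t) :
    Integrable (dominant n θ a t) :=
  ((integrable_rpow_mul_exp hn han (by linarith) ht).const_mul _).add (integrable_highBound _)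

theorem dominant_nonneg (ξ : Space n) : 0 ≤ dominant n θ a t ξ := by
  have := Real.rpow_nonneg (norm_nonneg ξ) (-a)
  unfold dominant highBound
  positivity

theorem integral_dominant_le (hn : 1 ≤ n) (h1 : θ ≤ 5 / 12) (han : a < n) (ht : 0 < t) :
    ∫ ξ, dominant n θ a t ξ ≤ 264 ^ 2 * (lowConst n a * t ^ (-((n - a) / (2 - 2 * θ))))
      + highBound n θ (1 / 32768) t * ∫ ξ : Space n, (1 + ‖ξ‖) ^ (-((n : ℝ) + 1)) := by
  unfold dominant
  rw [integral_add ((integrable_rpow_mul_exp hn han (by linarith) ht).const_mul _)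
    (integrable_highBound _), integral_const_mul, integral_const_mul]
  gcongr
  exact integral_rpow_mul_exp_le hn han (by linarith) ht

theorem norm_solution_sub_sq_le (hn : 1 ≤ n) (h0 : 0 < θ) (h1 : θ ≤ 5 / 12) (ha : 0 ≤ a)
    (han : a < n) (haθ : -(a / 2) ≤ 2 - 6 * θ) (ht : (n + 1) / (4 * θ * (1 / 32768) ^ 2) ≤ t)
    (hu : MemLp u₁ 2 volume) (hw : MemL1Weighted (2 * θ) u₁)
    (hφ : MemLp (profile θ u₁ t) 2 volume) :
    ‖solution θ (hu.toLp u₁) t - invHat (profile θ u₁ t) hφ‖ ^ 2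
      ≤ (normL1 u₁ + normL1Weighted (2 * θ) u₁) ^ 2 * ∫ ξ, dominant n θ a t ξ := by
  have htpos : 0 < t := lt_of_lt_of_le (by positivity) ht
  have e0 : ‖solution θ (hu.toLp u₁) t - invHat (profile θ u₁ t) hφ‖
      = ‖(𝓕 (solution θ (hu.toLp u₁) t) : L2 n) - (memLp_dilate hφ).toLp _‖ := by
    have : (𝓕 (invHat (profile θ u₁ t) hφ) : L2 n) = (memLp_dilate hφ).toLp _ :=
      (Lp.fourierTransformₗᵢ (Space n) ℂ).apply_symm_apply _
    rw [← this, ← Lp.norm_fourier_eq]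
    congr 1
    exact (Lp.fourierTransformₗᵢ (Space n) ℂ).map_sub _ _
  have hpi : (1 : ℝ) ≤ 2 * Real.pi := by linarith [Real.pi_gt_three]
  have hd := integrable_dominant (θ := θ) hn h1 han htpos
  set A := normL1 u₁ + normL1Weighted (2 * θ) u₁
  have hcomp := Measure.integral_comp_smul_of_nonneg (volume : Measure (Space n))
    (dominant n θ a t) (2 * Real.pi) (hR := by linarith)
  rw [e0, norm_sq_eq_integral]
  calc _ ≤ ∫ η : Space n, A ^ 2 * dominant n θ a t ((2 * Real.pi) • η) := by
        refine integral_mono_of_nonneg (Eventually.of_forall fun _ => sq_nonneg _)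
          ((hd.comp_smul (by linarith)).const_mul _) ?_
        have mK : Measurable fun ξ : Space n => kernel (logSymbol θ ξ) ‖ξ‖ t :=
          measurable_kernel measurable_logSymbol measurable_norm measurable_const
        filter_upwards [Lp.coeFn_sub (𝓕 (solution θ (hu.toLp u₁) t) : L2 n)
            ((memLp_dilate hφ).toLp _), (memLp_dilate hφ).coeFn_toLp,
          coeFn_fourier_fourierMul mK
            (fun ξ => abs_kernel_le (r := ‖ξ‖) (logSymbol_nonneg (θ := θ) ξ) htpos.le)
            (hu.toLp u₁), fourier_toLp_ae_eq hw.1 hu,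
          ae_comp_smul (ae_norm_pos hn) (by positivity : 2 * Real.pi ≠ 0)] with η k1 k2 k3 k4 k5
        rw [k1, Pi.sub_apply, k2, solution, k3, k4, profile_eq]
        exact sq_norm_difference_le h0 h1 ha haθ ht k5 (norm_fourier_le_normL1 η)
          (norm_integral_le_integral_norm _) normL1Weighted_nonneg
          (norm_fourier_sub_integral_le (by linarith) (by linarith) hw η)
    _ = A ^ 2 * (((2 * Real.pi) ^ n)⁻¹ * ∫ ξ, dominant n θ a t ξ) := by
      rw [integral_const_mul, hcomp, finrank_euclideanSpace_fin, smul_eq_mul]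
    _ ≤ _ := by
      have : 0 ≤ ∫ ξ, dominant n θ a t ξ := integral_nonneg dominant_nonneg
      gcongr
      -- The Jacobian (2π)⁻ⁿ of the change of frequency variable is at most 1 and is dropped.
      exact mul_le_of_le_one_left this (inv_le_one_of_one_le₀ (one_le_pow₀ hpi))

/-- Well-posedness and the asymptotic profile, with the decay rate `t ^ (-(n - a) / (4 (1 - θ)))`
for every admissible `a`. -/
theorem exists_solution_and_decay (hn : 1 ≤ n) (ha : 0 ≤ a) (han : a < n) :
    ∃ C : ℝ, 0 < C ∧ ∀ θ : ℝ, 0 < θ → θ ≤ 5 / 12 → -(a / 2) ≤ 2 - 6 * θ → ∃ T : ℝ, 0 < T ∧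
      ∀ (u₁ : Space n → ℂ) (hu₁ : MemLp u₁ 2 volume), MemL1Weighted (2 * θ) u₁ →
        ∀ t : ℝ, T ≤ t → ∃ hφ : MemLp (profile θ u₁ t) 2 volume,
          ‖solution θ (hu₁.toLp u₁) t - invHat (profile θ u₁ t) hφ‖ ≤
            C * (normL1 u₁ + normL1Weighted (2 * θ) u₁) *
              t ^ (-((n - a) / (4 * (1 - θ)))) := by
  have hlow := lowConst_nonneg n a
  -- The summand 1 pays for the high frequencies, which after time T₁ lie below the same power of t.
  -- All dependence on θ goes into T.
  refine ⟨√(264 ^ 2 * lowConst n a + 1), by positivity, fun θ h0 h1 haθ => ?_⟩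
  obtain ⟨T₁, hT₁⟩ := eventually_atTop.1 (eventually_highBound_mul_le (n := n) (δ := 1 / 32768)
    (θ := θ) (by norm_num) (∫ ξ : Space n, (1 + ‖ξ‖) ^ (-((n : ℝ) + 1))) ((n - a) / (2 - 2 * θ)))
  set T₂ : ℝ := (n + 1) / (4 * θ * (1 / 32768) ^ 2)
  have hT₂ : 0 < T₂ := by positivity
  refine ⟨max T₁ T₂, lt_max_of_lt_right hT₂, fun u₁ hu hw t ht => ?_⟩
  have ht1 : T₁ ≤ t := (le_max_left _ _).trans ht
  have ht2 : T₂ ≤ t := (le_max_right _ _).trans ht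
  have ht0 : 0 < t := hT₂.trans_le ht2
  have hφ := memLp_profile hn h0 h1 ht2 u₁
  have hA : 0 ≤ normL1 u₁ + normL1Weighted (2 * θ) u₁ :=
    add_nonneg normL1_nonneg normL1Weighted_nonneg
  refine ⟨hφ, ?_⟩
  refine (sq_le_sq₀ (norm_nonneg _) (by positivity)).1 ?_
  have hsq : (t ^ (-((n - a) / (4 * (1 - θ))))) ^ 2 = t ^ (-((n - a) / (2 - 2 * θ))) := by
    rw [← Real.rpow_natCast, ← Real.rpow_mul ht0.le]
    congr 1
    have : 1 - θ ≠ 0 := by linarith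
    have : 2 - 2 * θ ≠ 0 := by linarith
    push_cast
    field_simp
    ring
  rw [mul_pow, mul_pow, hsq, Real.sq_sqrt (by positivity), mul_comm _ (_ ^ 2), mul_assoc]
  refine (norm_solution_sub_sq_le hn h0 h1 ha han haθ ht2 hu hw hφ).trans ?_
  gcongr
  have := integral_dominant_le (θ := θ) hn h1 han ht0
  have := hT₁ t ht1
  linarith

end Decay

/-! ### Assembly of the two theorem parts -/

/-- Adding a nonnegative second rate weakens the decay estimate. -/
theorem le_mul_rate_add {x A C C' r s θ : ℝ} (hA : 0 ≤ A) (hr : 0 ≤ r) (hs : 0 ≤ s)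
    (hC : 0 ≤ C) (hCC' : C ≤ C') (h : x ≤ C * A * r) :
    x ≤ C' * A * (r + 1 / √θ * s) := by
  have h1 : 0 ≤ 1 / √θ * s := by positivity
  have hC' : 0 ≤ C' := hC.trans hCC'
  refine h.trans ?_
  gcongr
  linarith

theorem normL1_add_normL1Weighted_nonneg {n : ℕ} {γ : ℝ} {f : Space n → ℂ} :
    0 ≤ normL1 f + normL1Weighted γ f :=
  add_nonneg normL1_nonneg normL1Weighted_nonneg

end LogDampedWave

end

theorem theorem1p1 :
    -- (I) dimension one; the constant `C` is absolute, the time `T` depends on `θ` only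
    (∃ C : ℝ, 0 < C ∧ ∀ θ : ℝ, 0 < θ → θ ≤ 1 / 3 → ∃ T : ℝ, 0 < T ∧
      ∀ (u₁ : LogDampedWave.Space 1 → ℂ) (hu₁ : MemLp u₁ 2 volume),
        LogDampedWave.MemL1Weighted (2 * θ) u₁ →
        ∃ u : ℝ → LogDampedWave.L2 1,
          LogDampedWave.IsMildSolution θ 0 (hu₁.toLp u₁) u ∧
          (∀ u' : ℝ → LogDampedWave.L2 1,
            LogDampedWave.IsMildSolution θ 0 (hu₁.toLp u₁) u' → EqOn u' u (Ici 0)) ∧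
          ∀ t : ℝ, T ≤ t →
            ∃ hφ : MemLp (LogDampedWave.profile θ u₁ t) 2 volume,
              (θ ≤ 1 / 6 →
                ‖u t - LogDampedWave.invHat (LogDampedWave.profile θ u₁ t) hφ‖ ≤
                  C * (LogDampedWave.normL1 u₁ + LogDampedWave.normL1Weighted (2 * θ) u₁) *
                    (t ^ (-(1 / (4 * (1 - θ)))) + 1 / Real.sqrt θ * t ^ (-(1 / (4 * θ))))) ∧
              (1 / 6 < θ →
                ‖u t - LogDampedWave.invHat (LogDampedWave.profile θ u₁ t) hφ‖ ≤
                  C * (LogDampedWave.normL1 u₁ + LogDampedWave.normL1Weighted (2 * θ) u₁) *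
                    (t ^ (-(1 / (4 * (1 - θ))))
                      + 1 / Real.sqrt θ * t ^ (-((5 / 3 - 4 * θ) / (4 * θ)))))) ∧
    -- (II) dimension `n ≥ 2`; `C` depends on `n` only, `T` depends on `n` and `θ` only
    (∀ n : ℕ, 2 ≤ n → ∃ C : ℝ, 0 < C ∧ ∀ θ : ℝ, 0 < θ → θ ≤ 5 / 12 → ∃ T : ℝ, 0 < T ∧
      ∀ (u₁ : LogDampedWave.Space n → ℂ) (hu₁ : MemLp u₁ 2 volume),
        LogDampedWave.MemL1Weighted (2 * θ) u₁ →
        ∃ u : ℝ → LogDampedWave.L2 n,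
          LogDampedWave.IsMildSolution θ 0 (hu₁.toLp u₁) u ∧
          (∀ u' : ℝ → LogDampedWave.L2 n,
            LogDampedWave.IsMildSolution θ 0 (hu₁.toLp u₁) u' → EqOn u' u (Ici 0)) ∧
          ∀ t : ℝ, T ≤ t →
            ∃ hφ : MemLp (LogDampedWave.profile θ u₁ t) 2 volume,
              (θ ≤ 1 / 6 →
                ‖u t - LogDampedWave.invHat (LogDampedWave.profile θ u₁ t) hφ‖ ≤
                  C * (LogDampedWave.normL1 u₁ + LogDampedWave.normL1Weighted (2 * θ) u₁) *
                    (t ^ (-((n : ℝ) / (4 * (1 - θ))))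
                      + 1 / Real.sqrt θ * t ^ (-((n : ℝ) / (4 * θ))))) ∧
              (1 / 6 < θ → θ ≤ 1 / 3 →
                ‖u t - LogDampedWave.invHat (LogDampedWave.profile θ u₁ t) hφ‖ ≤
                  C * (LogDampedWave.normL1 u₁ + LogDampedWave.normL1Weighted (2 * θ) u₁) *
                    (t ^ (-((n : ℝ) / (4 * (1 - θ))))
                      + 1 / Real.sqrt θ * t ^ (-(((n : ℝ) - 4 * θ + 2 / 3) / (4 * θ))))) ∧
              (1 / 3 < θ →
                ‖u t - LogDampedWave.invHat (LogDampedWave.profile θ u₁ t) hφ‖ ≤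
                  C * (LogDampedWave.normL1 u₁ + LogDampedWave.normL1Weighted (2 * θ) u₁) *
                    (t ^ (-(((n : ℝ) - 1) / (4 * (1 - θ))))
                      + 1 / Real.sqrt θ * t ^ (-(((n : ℝ) - 1) / (4 * θ)))))) := by
  open LogDampedWave in
  constructor
  -- For θ ≤ 1/3 the exponent 2 - 6θ is nonnegative, so no singular weight is needed.
  · obtain ⟨C, hC, H⟩ := exists_solution_and_decay (n := 1) (a := 0) le_rfl le_rfl (by norm_num)
    refine ⟨C, hC, fun θ h0 h1 => ?_⟩
    obtain ⟨T, hT, HT⟩ := H θ h0 (by linarith) (by linarith)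
    refine ⟨T, hT, fun u₁ hu₁ hw => ?_⟩
    have hsol := isMildSolution_solution h0 (by linarith) (hu₁.toLp u₁)
    refine ⟨_, hsol, fun u' hu' => eqOn_of_isMildSolution h0 (by linarith) hsol hu',
      fun t ht => ?_⟩
    obtain ⟨hφ, hle⟩ := HT u₁ hu₁ hw t ht
    have ht0 : 0 ≤ t := hT.le.trans ht
    simp only [Nat.cast_one, sub_zero] at hle
    exact ⟨hφ, fun _ => le_mul_rate_add normL1_add_normL1Weighted_nonneg
        (Real.rpow_nonneg ht0 _) (Real.rpow_nonneg ht0 _) hC.le le_rfl hle,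
      fun _ => le_mul_rate_add normL1_add_normL1Weighted_nonneg
        (Real.rpow_nonneg ht0 _) (Real.rpow_nonneg ht0 _) hC.le le_rfl hle⟩
  · intro n hn
    have hn2 : (2 : ℝ) ≤ n := by exact_mod_cast hn
    have hn1 : 1 ≤ n := by omega
    obtain ⟨C, hC, H⟩ := exists_solution_and_decay (n := n) (a := 0) hn1 le_rfl (by linarith)
    -- For a = 1 the condition 2 - 6θ ≥ -1/2 holds exactly up to θ = 5/12, and a < n requires n ≥ 2.
    -- This produces the numerator n - 1 in the last range.
    obtain ⟨D, hD, H'⟩ := exists_solution_and_decay (n := n) (a := 1) hn1 zero_le_one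
      (by linarith)
    refine ⟨max C D, lt_max_of_lt_left hC, fun θ h0 h1 => ?_⟩
    rcases le_or_gt θ (1 / 3) with h2 | h2
    · obtain ⟨T, hT, HT⟩ := H θ h0 h1 (by linarith)
      refine ⟨T, hT, fun u₁ hu₁ hw => ?_⟩
      have hsol := isMildSolution_solution h0 (by linarith) (hu₁.toLp u₁)
      refine ⟨_, hsol, fun u' hu' => eqOn_of_isMildSolution h0 (by linarith) hsol hu',
        fun t ht => ?_⟩
      obtain ⟨hφ, hle⟩ := HT u₁ hu₁ hw t ht
      have ht0 : 0 ≤ t := hT.le.trans ht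
      rw [sub_zero] at hle
      exact ⟨hφ, fun _ => le_mul_rate_add normL1_add_normL1Weighted_nonneg
          (Real.rpow_nonneg ht0 _) (Real.rpow_nonneg ht0 _) hC.le (le_max_left C D) hle,
        fun _ _ => le_mul_rate_add normL1_add_normL1Weighted_nonneg
          (Real.rpow_nonneg ht0 _) (Real.rpow_nonneg ht0 _) hC.le (le_max_left C D) hle,
        fun h => absurd h h2.not_gt⟩
    · obtain ⟨T, hT, HT⟩ := H' θ h0 h1 (by linarith)
      refine ⟨T, hT, fun u₁ hu₁ hw => ?_⟩
      have hsol := isMildSolution_solution h0 (by linarith) (hu₁.toLp u₁)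
      refine ⟨_, hsol, fun u' hu' => eqOn_of_isMildSolution h0 (by linarith) hsol hu',
        fun t ht => ?_⟩
      obtain ⟨hφ, hle⟩ := HT u₁ hu₁ hw t ht
      have ht0 : 0 ≤ t := hT.le.trans ht
      exact ⟨hφ, fun h => absurd h (by linarith), fun _ h => absurd h h2.not_ge,
        fun _ => le_mul_rate_add normL1_add_normL1Weighted_nonneg
          (Real.rpow_nonneg ht0 _) (Real.rpow_nonneg ht0 _) hD.le (le_max_right C D) hle⟩
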